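/- A Dyck path of semilength $n$ is a lattice path from $(0,0)$ to $(2n,0)$ with steps $U=(1,1)$ and $D=(1,-1)$ that never goes below the $x$-axis. For $n\ge 0$ let $\mathbb{F}_n^2$ be the set of Dyck paths of semilength $n$ that contain neither $DUU$ nor $DDD$ as a sequence of consecutive steps, ordered by $P\le Q$ if and only if $P$ lies weakly below $Q$ at every abscissa. The first ascent of a path is its maximal initial run of $U$ steps. Let $J(x,y)$ be the generating function in which the coefficient of $x^ny^k$ is the number of intervals $[P,Q]$ (that is, of pairs $P\le Q$) in $\mathbb{F}_n^2$ such that the length of the first ascent of $Q$ minus that of $P$ equals $k$. Let $\sqrt{x^4-2x^3-x^2-2x+1}$ denote the formal power series square root with constant term $1$. Then $$J(x,y)=\frac{1+x-x^2+\sqrt{x^4-2x^3-x^2-2x+1}}{(1-x^2)\sqrt{x^4-2x^3-x^2-2x+1}+1+x^4-x^3-2(y+1)x^2-x}.$$ The generating function $J(x,1)$ for the number of all intervals of $\mathbb{F}_n^2$ is $$J(x,1)=\frac{-x^2+3x-1+\sqrt{x^4-2x^3-x^2-2x+1}}{2x(x^2-3x+1)(x+1)}.$$ The coefficient of $x^n$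 in $J(x,1)$, that is, the number of intervals of $\mathbb{F}_n^2$, is asymptotically equivalent, as $n\to\infty$, to $$\frac{11+5\sqrt5}{20}\,\sqrt{\frac{14\sqrt5-30}{\pi}}\; n^{-1/2}\left(\frac{3+\sqrt5}{2}\right)^n.$$ -/

import Mathlib

open PowerSeries (X C)

/-- `FibPath p n` is the set of Dyck paths of semilength `n` that avoid the consecutive patterns
`DUU` and `D^(p+1)`. -/
@[ext]
structure FibPath (p n : ℕ) where
  path : DyckWord
  semilength_eq : path.semilength = n
  avoids_DUU : ¬ [DyckStep.D, DyckStep.U, DyckStep.U] <:+: path.toList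
  avoids_D_run : ¬ List.replicate (p + 1) DyckStep.D <:+: path.toList

namespace FibPath

variable {p n : ℕ}

/-- The ordinate reached after the first `i` steps. -/
def height (P : FibPath p n) (i : ℕ) : ℤ :=
  ((P.path.toList.take i).count DyckStep.U : ℤ) - (P.path.toList.take i).count DyckStep.D

/-- The length of the first ascent: the number of up steps before the first down step. -/
def firstAscent (P : FibPath p n) : ℕ :=
  (P.path.toList.takeWhile (fun s => decide (s = DyckStep.U))).length

theorem length_eq (P : FibPath p n) : P.path.toList.length = 2 * n := by
  rw [← P.path.two_mul_semilength_eq_length, P.semilength_eq]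

theorem firstAscent_le (P : FibPath p n) : P.firstAscent ≤ n := by
  have h1 : (P.path.toList.takeWhile (fun s => decide (s = DyckStep.U))).count DyckStep.U
      = P.firstAscent := by
    unfold firstAscent
    rw [List.count_eq_length]
    intro b hb
    have := List.mem_takeWhile_imp hb
    simpa [eq_comm] using this
  have h2 : P.path.toList.count DyckStep.U = n := P.semilength_eq
  exact h1.symm.le.trans (((List.takeWhile_sublist _).count_le _).trans h2.le)

theorem eq_of_height_eq {P Q : FibPath p n} (h : ∀ i, P.height i = Q.height i) : P = Q := by
  have step : ∀ (R : FibPath p n) (i : ℕ) (hi : i < R.path.toList.length),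
      R.height (i + 1) = R.height i + if R.path.toList[i] = DyckStep.U then 1 else -1 := by
    intro R i hi
    unfold height
    rw [List.take_add_one, List.getElem?_eq_getElem hi]
    rcases DyckStep.dichotomy R.path.toList[i] with h | h <;>
      simp [h, List.count_append] <;> ring
  ext1
  apply DyckWord.ext
  refine List.ext_getElem (by rw [P.length_eq, Q.length_eq]) ?_
  intro i h1 h2
  have e1 := step P i h1
  have e2 := step Q i h2
  rw [h, h, e2] at e1
  rcases DyckStep.dichotomy P.path.toList[i] with hp | hp <;>
    rcases DyckStep.dichotomy Q.path.toList[i] with hq | hq <;>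
    simp_all

/-- The Stanley order: `P ≤ Q` when the path `P` is everywhere weakly below the path `Q`. -/
instance : PartialOrder (FibPath p n) where
  le P Q := ∀ i, P.height i ≤ Q.height i
  le_refl _ _ := le_rfl
  le_trans _ _ _ h1 h2 i := (h1 i).trans (h2 i)
  le_antisymm _ _ h1 h2 := eq_of_height_eq fun i => le_antisymm (h1 i) (h2 i)

instance : Finite (FibPath p n) :=
  Finite.of_injective
    (fun P : FibPath p n => (⟨P.path, P.semilength_eq⟩ : {w : DyckWord // w.semilength = n}))
    (fun _ _ h => FibPath.ext (congrArg Subtype.val h))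

instance : Finite (NonemptyInterval (FibPath p n)) :=
  Finite.of_injective NonemptyInterval.toProd NonemptyInterval.toProd_injective

end FibPath

/-- The number of intervals `[P, Q]` of the poset of `DUU`- and `D^(p+1)`-avoiding Dyck paths of
semilength `n` (an interval is given by its endpoints `P ≤ Q`). -/
noncomputable def intervalCount (p n : ℕ) : ℕ :=
  Nat.card (NonemptyInterval (FibPath p n))

/-- The number of those intervals `[P, Q]` for which the first ascent of `Q` is longer than the
first ascent of `P` by exactly `k`. -/
noncomputable def intervalCountDiff (p n k : ℕ) : ℕ :=
  Nat.card {I : NonemptyInterval (FibPath p n) // I.snd.firstAscent = I.fst.firstAscent + k}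

/-- The generating function `J(x, y)`, as a power series in `x` whose coefficients are polynomials
in `y`; the coefficient of `x^n y^k` is `intervalCountDiff 2 n k`. -/
noncomputable def fibJ : PowerSeries (Polynomial ℚ) :=
  PowerSeries.mk fun n =>
    ∑ k ∈ Finset.range (n + 1), Polynomial.monomial k (intervalCountDiff 2 n k : ℚ)

/-- The range `k ≤ n` in `fibJ` omits nothing. -/
theorem coeff_fibJ (n k : ℕ) :
    (PowerSeries.coeff n fibJ).coeff k = (intervalCountDiff 2 n k : ℚ) := by
  simp only [fibJ, PowerSeries.coeff_mk, Polynomial.finsetSum_coeff, Polynomial.coeff_monomial]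
  rw [Finset.sum_ite_eq']
  split_ifs with h
  · rfl
  · have : IsEmpty {I : NonemptyInterval (FibPath 2 n) //
        I.snd.firstAscent = I.fst.firstAscent + k} := by
      refine ⟨fun I => ?_⟩
      have h1 := I.2
      have h2 := I.1.snd.firstAscent_le
      simp only [Finset.mem_range] at h
      omega
    simp [intervalCountDiff]

/-- The generating function of the number of all intervals, by semilength. -/
noncomputable def fibJ1 : PowerSeries ℚ :=
  PowerSeries.mk fun n => (intervalCount 2 n : ℚ)

/-- The numerator of `J(x, y)`, with `S` in the place of the square root. -/
noncomputable def numJ (S : PowerSeries ℚ) : PowerSeries (Polynomial ℚ) :=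
  1 + X - X ^ 2 + PowerSeries.map Polynomial.C S

/-- The denominator of `J(x, y)`, with `S` in the place of the square root;
the variable `y` is `C Polynomial.X`. -/
noncomputable def denJ (S : PowerSeries ℚ) : PowerSeries (Polynomial ℚ) :=
  (1 - X ^ 2) * PowerSeries.map Polynomial.C S
    + 1 + X ^ 4 - X ^ 3 - 2 * (C Polynomial.X + 1) * X ^ 2 - X

/-! Avoiding `DUU` forces every up step after the first down step to be followed at once by a down
step. Such a path is therefore an initial run of up steps followed by blocks `UD` (letter `true`)
and `D` (letter `false`), the last up step of the first ascent being absorbed in the first block.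
The length of the initial run is forced by balance, and avoiding `DDD` means that no two consecutive
letters are `false`. One path lies below another iff each of its down steps comes no later, that is,
iff every suffix of its word contains at least as many `true` (`IsCode.toFibPath_le_iff`); the
difference of the first ascents is the difference of the numbers of `true`.

An interval is thus a word of pairs of letters whose running difference, read from the right, stays
nonnegative. Adding letters on the left gives a linear system in which `y` marks the difference, and
elimination leaves one equation relating `J(x,y)` and `J(x,0)` (`kernel_equation`). Rather than
cancelling the kernel, the proof checks that the closed form satisfies this equation and that the
solution is unique (`eq_zero_of_mul_eq_X_mul`). Setting `y = 1` gives `J(x,1)`.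

For the asymptotics, the radicand is `(x² - 3x + 1)(x² + x + 1)`. With `ρ < t` the roots of `x² - 3x
+ 1`, so `t = 1/ρ`, the series `2x J(x,1)` is `g(x) (1 - t x)^(-1/2) - 1/(1 + x)` with `g`
absolutely convergent at `2ρ` (`map_fibJ1_eq`). Dominated convergence and Wallis' product transfer
the singularity to the coefficients, with constant `g(ρ) / (2ρ√π)`. -/

open DyckStep (U D)

/-! ### Paths as binary words -/

/-- The lattice steps encoded by a list of letters: `true` stands for an up step followed
by a down step, `false` for a single down step. -/
def stepsOf (l : List Bool) : List DyckStep :=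
  l.flatMap fun b => if b then [U, D] else [D]

@[simp] theorem stepsOf_nil : stepsOf [] = [] := rfl

@[simp] theorem stepsOf_cons_true (l : List Bool) : stepsOf (true :: l) = U :: D :: stepsOf l := rfl

@[simp] theorem stepsOf_cons_false (l : List Bool) : stepsOf (false :: l) = D :: stepsOf l := rfl

theorem count_D_stepsOf (l : List Bool) : (stepsOf l).count D = l.length := by
  induction l with
  | nil => rfl
  | cons b l ih => cases b <;> simp [ih]

theorem count_U_stepsOf (l : List Bool) : (stepsOf l).count U = l.count true := by
  induction l with
  | nil => rfl
  | cons b l ih => cases b <;> simp [ih]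

theorem count_false_add_count_true (l : List Bool) :
    l.count false + l.count true = l.length := by
  induction l with
  | nil => rfl
  | cons b l ih => cases b <;> simp <;> omega

theorem count_U_add_count_D (l : List DyckStep) : l.count U + l.count D = l.length := by
  induction l with
  | nil => rfl
  | cons b l ih => cases b <;> simp <;> omega

/-- A letter `false` lowers the path by one and a letter `true` brings it back to its level, so
`l.count false` initial up steps suffice to stay above the axis. -/
theorem count_D_take_stepsOf_le (l : List Bool) (i : ℕ) :
    ((stepsOf l).take i).count D ≤ l.count false + ((stepsOf l).take i).count U := by
  induction l generalizing i with
  | nil => simp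
  | cons b l ih =>
    cases b
    · rcases i with _ | i
      · simp
      · have := ih i
        simp; omega
    · rcases i with _ | _ | i
      · simp
      · simp
      · have := ih i
        simp; omega

theorem count_D_take_replicate_append_le {w : List DyckStep} (k m : ℕ)
    (h : ∀ i, (w.take i).count D ≤ k + m + (w.take i).count U) (i : ℕ) :
    ((List.replicate k U ++ w).take i).count D
      ≤ m + ((List.replicate k U ++ w).take i).count U := by
  induction k generalizing i m with
  | zero => simpa using h i
  | succ k ih =>
    rcases i with _ | i
    · simp
    · have := ih (m + 1) (fun i => (h i).trans (by omega)) i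
      simp only [List.replicate_succ, List.cons_append, List.take_succ_cons, List.count_cons_self]
      rw [List.count_cons_of_ne (by simp)]
      omega

/-- The position of the `j`-th down step. -/
theorem lt_count_D_take_stepsOf (l : List Bool) (i j : ℕ) (hj : j < l.length) :
    j < ((stepsOf l).take i).count D ↔ (l.take (j + 1)).count true + j < i := by
  induction l generalizing i j with
  | nil => simp at hj
  | cons b l ih =>
    cases b
    · rcases i with _ | i
      · simp
      · rcases j with _ | j
        · simp
        · have := ih i j (by simpa using hj)
          simp at this ⊢; omega
    · rcases i with _ | _ | i
      · simp
      · simp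
      · rcases j with _ | j
        · simp
        · have := ih i j (by simpa using hj)
          simp at this ⊢; omega

theorem lt_count_D_take (l : List Bool) (k i j : ℕ) (hj : j < l.length) :
    j < ((List.replicate k U ++ stepsOf l).take i).count D
      ↔ k + (l.take (j + 1)).count true + j < i := by
  induction k generalizing i with
  | zero => simpa using lt_count_D_take_stepsOf l i j hj
  | succ k ih =>
    rcases i with _ | i
    · simp
    · have := ih i
      simp only [List.replicate_succ, List.cons_append, List.take_succ_cons]
      rw [List.count_cons_of_ne (by simp), this]
      omega

/-- No two consecutive letters are `false`. -/
abbrev NoFalseFalse (l : List Bool) : Prop := l.IsChain fun a b => (a || b) = true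

/-- Every letter ends in `D`; the `D` in front stands for the end of a preceding letter, so that a
block `DDD` is such a final `D` followed by two letters `false`. -/
theorem DDD_infix_iff (l : List Bool) :
    ¬ [D, D, D] <:+: D :: stepsOf l ↔ NoFalseFalse l := by
  induction l with
  | nil => simp [NoFalseFalse, List.infix_cons_iff]
  | cons b l ih =>
    cases b
    · rcases l with _ | ⟨b, l⟩
      · simp [NoFalseFalse, List.infix_cons_iff]
      · cases b
        · simp [NoFalseFalse, List.infix_cons_iff]
        · simp [NoFalseFalse, List.infix_cons_iff] at ih ⊢
          simpa using ih
    · rcases l with _ | ⟨b, l⟩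
      · simp [NoFalseFalse, List.infix_cons_iff]
      · simp [NoFalseFalse, List.infix_cons_iff] at ih ⊢
        simpa using ih

theorem DDD_infix_replicate_append_iff (w : List DyckStep) (k : ℕ) :
    [D, D, D] <:+: List.replicate k U ++ w ↔ [D, D, D] <:+: w := by
  induction k with
  | zero => simp
  | succ k ih => simpa [List.replicate_succ, List.infix_cons_iff] using ih

theorem DUU_infix_replicate_append_iff (w : List DyckStep) (k : ℕ) :
    [D, U, U] <:+: List.replicate k U ++ w ↔ [D, U, U] <:+: w := by
  induction k with
  | zero => simp
  | succ k ih => simpa [List.replicate_succ, List.infix_cons_iff] using ih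

theorem not_DUU_infix_stepsOf (l : List Bool) : ¬ [D, U, U] <:+: D :: stepsOf l := by
  induction l with
  | nil => simp [List.infix_cons_iff]
  | cons b l ih =>
    cases b <;> simp [List.infix_cons_iff] at ih ⊢ <;> simpa using ih

/-- After a down step, an up step is neither followed by `U` nor last, so `w` can be cut greedily
into blocks `D` and `UD`. -/
theorem exists_eq_stepsOf (w : List DyckStep) (h : ¬ [D, U, U] <:+: D :: w)
    (hw : w.getLast? ≠ some U) : ∃ l, w = stepsOf l := by
  induction hn : w.length using Nat.strong_induction_on generalizing w with
  | _ n ih =>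
  match w, hn with
  | [], _ => exact ⟨[], rfl⟩
  | D :: w, hn =>
    have hl : w.getLast? ≠ some U := by
      rcases w with _ | ⟨a, w⟩
      · simp
      · simpa [List.getLast?_cons_cons] using hw
    obtain ⟨l, rfl⟩ := ih w.length (by simp at hn; omega) w
      (fun h' => h (h'.trans (List.suffix_cons _ _).isInfix)) hl rfl
    exact ⟨false :: l, rfl⟩
  | [U], _ => simp at hw
  | U :: U :: w, _ => exact absurd ⟨[], w, rfl⟩ h
  | U :: D :: w, hn =>
    have hl : w.getLast? ≠ some U := by
      rcases w with _ | ⟨a, w⟩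
      · simp
      · simpa [List.getLast?_cons_cons] using hw
    obtain ⟨l, rfl⟩ := ih w.length (by simp at hn; omega) w
      (fun h' => h (h'.trans ((List.suffix_cons _ _).trans (List.suffix_cons _ _)).isInfix)) hl rfl
    exact ⟨true :: l, rfl⟩

/-- The words encoding the paths of semilength `n`. -/
structure IsCode (n : ℕ) (l : List Bool) : Prop where
  length_eq : l.length = n
  noFalseFalse : NoFalseFalse l
  headD : l.headD true = true

theorem IsCode.eq_nil_or {n : ℕ} {l : List Bool} (h : IsCode n l) :
    l = [] ∨ ∃ t, l = true :: t := by
  rcases l with _ | ⟨b, t⟩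
  · simp
  · have := h.headD
    simp at this
    simp [this]

/-- The path encoded by a word. -/
def IsCode.toFibPath {n : ℕ} {l : List Bool} (h : IsCode n l) : FibPath 2 n where
  path :=
    { toList := List.replicate (l.count false) U ++ stepsOf l
      count_U_eq_count_D := by
        have := count_false_add_count_true l
        simp [count_D_stepsOf, count_U_stepsOf, List.count_replicate, this]
      count_D_le_count_U := fun i => by
        simpa using count_D_take_replicate_append_le (w := stepsOf l) (l.count false) 0
          (by simpa using count_D_take_stepsOf_le l) i }
  semilength_eq := by
    have := count_false_add_count_true l
    simp [DyckWord.semilength, count_U_stepsOf, this, h.length_eq]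
  avoids_DUU := by
    rw [DUU_infix_replicate_append_iff]
    exact fun h' => not_DUU_infix_stepsOf l (h'.trans (List.suffix_cons _ _).isInfix)
  avoids_D_run := by
    show ¬ [D, D, D] <:+: _
    rw [DDD_infix_replicate_append_iff]
    exact fun h' => (DDD_infix_iff l).2 h.noFalseFalse (h'.trans (List.suffix_cons _ _).isInfix)

theorem IsCode.toList_toFibPath {n : ℕ} {l : List Bool} (h : IsCode n l) :
    h.toFibPath.path.toList = List.replicate (l.count false) U ++ stepsOf l := rfl

theorem IsCode.firstAscent_toFibPath {n : ℕ} {l : List Bool} (h : IsCode n l) :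
    h.toFibPath.firstAscent = if l = [] then 0 else l.count false + 1 := by
  unfold FibPath.firstAscent
  rw [h.toList_toFibPath]
  have key : ∀ k : ℕ, ((List.replicate k U ++ stepsOf l).takeWhile
      (fun s => decide (s = U))).length = if l = [] then k else k + 1 := by
    intro k
    induction k with
    | zero => rcases h.eq_nil_or with rfl | ⟨t, rfl⟩ <;> simp
    | succ k ih =>
      rw [List.replicate_succ, List.cons_append, List.takeWhile_cons_of_pos (by simp),
        List.length_cons, ih]
      split_ifs <;> rfl
  rw [key]
  split_ifs with h0
  · simp [h0]
  · rfl

theorem FibPath.height_eq {n : ℕ} (P : FibPath 2 n) (i : ℕ) :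
    P.height i = ((min i (2 * n) : ℕ) : ℤ) - 2 * (P.path.toList.take i).count D := by
  have h := count_U_add_count_D (P.path.toList.take i)
  rw [List.length_take, P.length_eq] at h
  unfold FibPath.height
  omega

theorem FibPath.le_iff_count_D {n : ℕ} (P Q : FibPath 2 n) :
    P ≤ Q ↔ ∀ i, (Q.path.toList.take i).count D ≤ (P.path.toList.take i).count D := by
  refine forall_congr' fun i => ?_
  rw [FibPath.height_eq, FibPath.height_eq]
  omega

theorem FibPath.count_D_take_le {n : ℕ} (P : FibPath 2 n) (i : ℕ) :
    (P.path.toList.take i).count D ≤ n := by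
  have h1 : P.path.toList.count U = n := P.semilength_eq
  rw [P.path.count_U_eq_count_D] at h1
  exact ((List.take_sublist _ _).count_le _).trans h1.le

/-- Counting from `0`, the `j`-th down step of the path of `l` is step `n + j - (l.drop (j +
1)).count true`, because the initial run has length `n - l.count true`. Being lower means having
each down step no later. -/
theorem IsCode.toFibPath_le_iff {n : ℕ} {l l' : List Bool} (h : IsCode n l) (h' : IsCode n l') :
    h.toFibPath ≤ h'.toFibPath ↔ ∀ j, (l'.drop j).count true ≤ (l.drop j).count true := by
  have e1 := count_false_add_count_true l
  have e2 := count_false_add_count_true l'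
  have t1 : ∀ j, (l.take j).count true + (l.drop j).count true = l.count true := fun j => by
    rw [← List.count_append, List.take_append_drop]
  have t2 : ∀ j, (l'.take j).count true + (l'.drop j).count true = l'.count true := fun j => by
    rw [← List.count_append, List.take_append_drop]
  have hl := h.length_eq
  have hl' := h'.length_eq
  rw [FibPath.le_iff_count_D]
  constructor
  · intro H
    have main : ∀ j, (l'.drop (j + 1)).count true ≤ (l.drop (j + 1)).count true := by
      intro j
      by_cases hj : j < n
      -- The chosen abscissa is the end of the `j`-th down step of the upper path.
      · have a := lt_count_D_take l (l.count false)
          (l'.count false + (l'.take (j + 1)).count true + j + 1) j (by omega)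
        have a' := lt_count_D_take l' (l'.count false)
          (l'.count false + (l'.take (j + 1)).count true + j + 1) j (by omega)
        have b := H (l'.count false + (l'.take (j + 1)).count true + j + 1)
        rw [h.toList_toFibPath, h'.toList_toFibPath] at b
        have := t1 (j + 1)
        have := t2 (j + 1)
        omega
      · rw [List.drop_eq_nil_of_le (by omega : l'.length ≤ j + 1)]
        simp
    intro j
    -- The full words are not reached by positions of down steps; nonempty codes both start with
    -- `true`, so this case reduces to the suffixes from index `1`.
    rcases j with _ | j
    · have := main 0
      rcases h.eq_nil_or with rfl | ⟨t, rfl⟩ <;> rcases h'.eq_nil_or with rfl | ⟨t', rfl⟩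
      · simp
      · simp at hl hl'; omega
      · simp
      · simpa using this
    · exact main j
  · intro H i
    by_contra hlt
    push Not at hlt
    set j := (h.toFibPath.path.toList.take i).count D with hj
    have hjn : j < n := hlt.trans_le (h'.toFibPath.count_D_take_le i)
    rw [h'.toList_toFibPath, lt_count_D_take _ _ _ _ (by omega)] at hlt
    have hn := (lt_count_D_take l (l.count false) i j (by omega)).not.1 (by
      rw [← h.toList_toFibPath, ← hj]; exact lt_irrefl _)
    have := t1 (j + 1)
    have := t2 (j + 1)
    have := H (j + 1)
    omega

theorem List.eq_of_count_true_drop_eq {l l' : List Bool} (hl : l.length = l'.length)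
    (h : ∀ j, (l.drop j).count true = (l'.drop j).count true) : l = l' := by
  induction l generalizing l' with
  | nil => simpa [eq_comm] using hl
  | cons b l ih =>
    rcases l' with _ | ⟨b', l'⟩
    · simp at hl
    · have ht : l = l' := ih (by simpa using hl) fun j => by simpa using h (j + 1)
      subst ht
      have := h 0
      cases b <;> cases b' <;> simp at this ⊢

theorem IsCode.eq_of_toFibPath_eq {n : ℕ} {l l' : List Bool} (h : IsCode n l) (h' : IsCode n l')
    (e : h.toFibPath = h'.toFibPath) : l = l' :=
  List.eq_of_count_true_drop_eq (h.length_eq.trans h'.length_eq.symm) fun j =>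
    le_antisymm ((h'.toFibPath_le_iff h).1 e.ge j) ((h.toFibPath_le_iff h').1 e.le j)

theorem exists_replicate_append (w : List DyckStep) :
    ∃ k v, w = List.replicate k U ++ v ∧ (v = [] ∨ ∃ v', v = D :: v') := by
  induction w with
  | nil => exact ⟨0, [], rfl, Or.inl rfl⟩
  | cons a w ih =>
    cases a
    · obtain ⟨k, v, rfl, hv⟩ := ih
      exact ⟨k + 1, v, by simp [List.replicate_succ], hv⟩
    · exact ⟨0, D :: w, rfl, Or.inr ⟨w, rfl⟩⟩

theorem FibPath.exists_code {n : ℕ} (P : FibPath 2 n) :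
    ∃ l, ∃ h : IsCode n l, h.toFibPath = P := by
  suffices ∃ l : List Bool, l.headD true = true ∧ ∃ k,
      P.path.toList = List.replicate k U ++ stepsOf l by
    obtain ⟨l, hd, k, hP⟩ := this
    have hU : P.path.toList.count U = n := P.semilength_eq
    have hD : P.path.toList.count D = n := by rw [← P.path.count_U_eq_count_D, hU]
    have e := count_false_add_count_true l
    simp only [hP, List.count_append, count_U_stepsOf, count_D_stepsOf,
      List.count_replicate] at hU hD
    simp at hU hD
    have hk : k = l.count false := by omega
    subst hk
    have hc : IsCode n l := by
      refine ⟨hD, (DDD_infix_iff l).1 fun h => ?_, hd⟩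
      have h2 : ¬ [D, D, D] <:+: P.path.toList := P.avoids_D_run
      rw [hP, DDD_infix_replicate_append_iff] at h2
      rcases l with _ | ⟨b, l⟩
      · simp [List.infix_cons_iff] at h
      · obtain rfl : b = true := by simpa using hd
        simp [List.infix_cons_iff] at h h2
        tauto
    exact ⟨l, hc, FibPath.ext (DyckWord.ext hP.symm)⟩
  obtain ⟨k, v, hw, hv⟩ := exists_replicate_append P.path.toList
  rcases hv with rfl | ⟨v, rfl⟩
  · exact ⟨[], rfl, k, by simpa using hw⟩
  · have h1 := P.avoids_DUU
    rw [hw, DUU_infix_replicate_append_iff] at h1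
    have hlast : v.getLast? ≠ some U := by
      intro hl
      have hne : P.path.toList ≠ [] := by rw [hw]; simp
      have h3 := P.path.getLast_eq_D hne
      have h4 : P.path.toList.getLast? = some D := by
        rw [List.getLast?_eq_getLast_of_ne_nil hne]
        simpa using h3
      rw [hw] at h4
      rcases v with _ | ⟨a, v⟩
      · simp at hl
      · rw [List.getLast?_append_of_ne_nil _ (by simp), List.getLast?_cons_cons, hl] at h4
        simp at h4
    obtain ⟨l, rfl⟩ := exists_eq_stepsOf v h1 hlast
    rcases k with _ | k
    · have := P.path.count_D_le_count_U 1
      rw [hw] at this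
      simp at this
    -- The last up step of the first ascent and the first down step form the first letter.
    · refine ⟨true :: l, rfl, k, ?_⟩
      rw [hw, List.replicate_succ', List.append_assoc]
      rfl

/-! ### Words of pairs and their recursion -/

/-- Neither coordinate is `false` in both letters. -/
def CompatiblePair (a b : Bool × Bool) : Prop := (a.1 || b.1) = true ∧ (a.2 || b.2) = true

/-- The pairs of words of length `n`, written as words of pairs, which encode the intervals of
length difference `h`, except that the first letter is `s`. -/
def pairWords (n : ℕ) (s : Bool × Bool) (h : ℕ) : Set (List (Bool × Bool)) :=
  {L | L.length = n ∧ L.IsChain CompatiblePair ∧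
    (∀ j, ((L.map Prod.snd).drop j).count true ≤ ((L.map Prod.fst).drop j).count true) ∧
    L.headD (true, true) = s ∧ (L.map Prod.fst).count true = (L.map Prod.snd).count true + h}

theorem finite_pairWords (n : ℕ) (s : Bool × Bool) (h : ℕ) : (pairWords n s h).Finite :=
  (List.finite_length_eq (Bool × Bool) n).subset fun _ hL => hL.1

theorem disjoint_pairWords {n h : ℕ} {s t : Bool × Bool} (hst : s ≠ t) :
    Disjoint (pairWords n s h) (pairWords n t h) :=
  Set.disjoint_left.2 fun _ h1 h2 => hst (h1.2.2.2.1.symm.trans h2.2.2.2.1)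

/-- The default `(true, true)` is compatible with every letter, so an empty tail imposes no
condition. -/
theorem isChain_compatiblePair_cons (x : Bool × Bool) (L : List (Bool × Bool)) :
    (x :: L).IsChain CompatiblePair ↔
      CompatiblePair x (L.headD (true, true)) ∧ L.IsChain CompatiblePair := by
  rcases L with _ | ⟨y, L⟩
  · simp [CompatiblePair]
  · simp

/-- The only new suffix inequality concerns the whole word, and it holds because the difference `h`
is a natural number. -/
theorem cons_mem_pairWords {n h : ℕ} {s x : Bool × Bool} {L : List (Bool × Bool)} :
    x :: L ∈ pairWords (n + 1) s h ↔ x = s ∧ ∃ k, L ∈ pairWords n (L.headD (true, true)) k ∧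
      CompatiblePair s (L.headD (true, true)) ∧ k + s.1.toNat = h + s.2.toNat := by
  unfold pairWords
  simp only [Set.mem_ofPred_eq, isChain_compatiblePair_cons, List.length_cons, List.map_cons,
    List.headD_cons, true_and, Nat.add_right_cancel_iff]
  have c : ∀ (b : Bool) (l : List Bool), (b :: l).count true = l.count true + b.toNat := by
    intro b l; cases b <;> simp
  constructor
  · rintro ⟨h1, ⟨h2, h3⟩, h4, rfl, h5⟩
    refine ⟨rfl, (L.map Prod.fst).count true - (L.map Prod.snd).count true,
      ⟨h1, h3, fun j => h4 (j + 1), ?_⟩, h2, ?_⟩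
    · have := h4 1
      simp at this ⊢
      omega
    · have := h4 1
      rw [c, c] at h5
      simp at this
      omega
  · rintro ⟨rfl, k, ⟨h1, h3, h4, h5⟩, h2, h6⟩
    have e : (x.1 :: L.map Prod.fst).count true = (x.2 :: L.map Prod.snd).count true + h := by
      rw [c, c]; omega
    refine ⟨h1, ⟨h2, h3⟩, fun j => ?_, rfl, e⟩
    rcases j with _ | j
    · simp only [List.drop_zero]; omega
    · exact h4 j

theorem pairWords_succ (n h : ℕ) (s : Bool × Bool) :
    pairWords (n + 1) s h = List.cons s ''
      {L | ∃ k, L ∈ pairWords n (L.headD (true, true)) k ∧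
        CompatiblePair s (L.headD (true, true)) ∧ k + s.1.toNat = h + s.2.toNat} := by
  ext L
  rcases L with _ | ⟨x, L⟩
  · simp [pairWords]
  · rw [cons_mem_pairWords]
    simp only [Set.mem_image, Set.mem_ofPred_eq, List.cons.injEq]
    constructor
    · rintro ⟨rfl, hL⟩; exact ⟨L, hL, rfl, rfl⟩
    · rintro ⟨L', hL, rfl, rfl⟩; exact ⟨rfl, hL⟩

theorem headD_of_mem_pairWords {n h : ℕ} {s : Bool × Bool} {L : List (Bool × Bool)}
    (hL : L ∈ pairWords n s h) : L.headD (true, true) = s := hL.2.2.2.1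

theorem ncard_pairWords_succ (n h : ℕ) (s : Bool × Bool) {A : Set (List (Bool × Bool))}
    (hA : ∀ L, L ∈ A ↔ ∃ k, L ∈ pairWords n (L.headD (true, true)) k ∧
        CompatiblePair s (L.headD (true, true)) ∧ k + s.1.toNat = h + s.2.toNat) :
    (pairWords (n + 1) s h).ncard = A.ncard := by
  rw [pairWords_succ, Set.ncard_image_of_injective _ List.cons_injective]
  congr 1
  ext L
  exact (hA L).symm

theorem mem_pairWords_iff {n h : ℕ} {s : Bool × Bool} {L : List (Bool × Bool)} :
    L ∈ pairWords n s h ↔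
      L ∈ pairWords n (L.headD (true, true)) h ∧ L.headD (true, true) = s := by
  constructor
  · intro hL
    have := headD_of_mem_pairWords hL
    exact ⟨this ▸ hL, this⟩
  · rintro ⟨h1, rfl⟩; exact h1

theorem ncard_pairWords_succ_tt (n h : ℕ) :
    (pairWords (n + 1) (true, true) h).ncard =
      (pairWords n (true, true) h).ncard + (pairWords n (true, false) h).ncard +
      (pairWords n (false, true) h).ncard + (pairWords n (false, false) h).ncard := by
  rw [ncard_pairWords_succ n h (true, true) (A := pairWords n (true, true) h ∪
    pairWords n (true, false) h ∪ pairWords n (false, true) h ∪ pairWords n (false, false) h)]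
  · rw [Set.ncard_union_eq _ (((finite_pairWords _ _ _).union (finite_pairWords _ _ _)).union
        (finite_pairWords _ _ _)) (finite_pairWords _ _ _),
      Set.ncard_union_eq _ ((finite_pairWords _ _ _).union (finite_pairWords _ _ _))
        (finite_pairWords _ _ _),
      Set.ncard_union_eq _ (finite_pairWords _ _ _) (finite_pairWords _ _ _)]
    all_goals simp [Set.disjoint_union_left, disjoint_pairWords]
  · intro L
    simp only [Set.mem_union]
    rw [mem_pairWords_iff (s := (true, true)), mem_pairWords_iff (s := (true, false)),
      mem_pairWords_iff (s := (false, true)), mem_pairWords_iff (s := (false, false))]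
    generalize L.headD (true, true) = t
    rcases t with ⟨_ | _, _ | _⟩ <;> simp [CompatiblePair]

theorem ncard_pairWords_succ_tf_zero (n : ℕ) :
    (pairWords (n + 1) (true, false) 0).ncard = 0 := by
  rw [ncard_pairWords_succ n 0 (true, false) (A := ∅)]
  · simp
  · simp

theorem ncard_pairWords_succ_tf_succ (n h : ℕ) :
    (pairWords (n + 1) (true, false) (h + 1)).ncard =
      (pairWords n (true, true) h).ncard + (pairWords n (false, true) h).ncard := by
  rw [ncard_pairWords_succ n (h + 1) (true, false)
    (A := pairWords n (true, true) h ∪ pairWords n (false, true) h)]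
  · rw [Set.ncard_union_eq _ (finite_pairWords _ _ _) (finite_pairWords _ _ _)]
    simp [disjoint_pairWords]
  · intro L
    simp only [Set.mem_union]
    rw [mem_pairWords_iff (s := (true, true)), mem_pairWords_iff (s := (false, true))]
    generalize L.headD (true, true) = t
    rcases t with ⟨_ | _, _ | _⟩ <;> simp [CompatiblePair]

/-- Prepending `(false, true)` lowers the difference, so tails of difference `0` are lost; this is
the `divX` in `pairPoly`. -/
theorem ncard_pairWords_succ_ft (n h : ℕ) :
    (pairWords (n + 1) (false, true) h).ncard =
      (pairWords n (true, true) (h + 1)).ncard + (pairWords n (true, false) (h + 1)).ncard := by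
  rw [ncard_pairWords_succ n h (false, true)
    (A := pairWords n (true, true) (h + 1) ∪ pairWords n (true, false) (h + 1))]
  · rw [Set.ncard_union_eq _ (finite_pairWords _ _ _) (finite_pairWords _ _ _)]
    simp [disjoint_pairWords]
  · intro L
    simp only [Set.mem_union]
    rw [mem_pairWords_iff (s := (true, true)), mem_pairWords_iff (s := (true, false))]
    generalize L.headD (true, true) = t
    rcases t with ⟨_ | _, _ | _⟩ <;> simp [CompatiblePair]

theorem ncard_pairWords_succ_ff (n h : ℕ) :
    (pairWords (n + 1) (false, false) h).ncard = (pairWords n (true, true) h).ncard := by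
  refine ncard_pairWords_succ n h (false, false) fun L => ?_
  rw [mem_pairWords_iff (s := (true, true))]
  generalize L.headD (true, true) = t
  rcases t with ⟨_ | _, _ | _⟩ <;> simp [CompatiblePair]

theorem ncard_pairWords_zero (h : ℕ) (s : Bool × Bool) :
    (pairWords 0 s h).ncard = if s = (true, true) ∧ h = 0 then 1 else 0 := by
  have : pairWords 0 s h = if s = (true, true) ∧ h = 0 then {[]} else ∅ := by
    ext L
    rcases L with _ | ⟨x, L⟩
    · split_ifs with h0
      · obtain ⟨rfl, rfl⟩ := h0
        simp [pairWords]
      · simp only [pairWords, Set.mem_ofPred_eq]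
        simp
        tauto
    · split_ifs <;> simp [pairWords]
  rw [this]
  split_ifs <;> simp

/-- The generating polynomial, by length difference, of `pairWords n s`. -/
noncomputable def pairPoly : ℕ → Bool × Bool → Polynomial ℚ
  | 0, s => if s = (true, true) then 1 else 0
  | n + 1, (true, true) => pairPoly n (true, true) + pairPoly n (true, false) +
      pairPoly n (false, true) + pairPoly n (false, false)
  | n + 1, (true, false) => Polynomial.X * (pairPoly n (true, true) + pairPoly n (false, true))
  | n + 1, (false, true) => (pairPoly n (true, true) + pairPoly n (true, false)).divX
  | n + 1, (false, false) => pairPoly n (true, true)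

theorem coeff_pairPoly (n h : ℕ) (s : Bool × Bool) :
    (pairPoly n s).coeff h = (pairWords n s h).ncard := by
  induction n generalizing h s with
  | zero =>
    rw [ncard_pairWords_zero, pairPoly]
    by_cases hs : s = (true, true)
    · simp [hs, Polynomial.coeff_one]
    · simp [hs]
  | succ n ih =>
    rcases s with ⟨_ | _, _ | _⟩
    · simp [pairPoly, ih, ncard_pairWords_succ_ff]
    · simp [pairPoly, ih, ncard_pairWords_succ_ft]
    · rcases h with _ | h
      · simp [pairPoly, ncard_pairWords_succ_tf_zero]
      · simp [pairPoly, ih, ncard_pairWords_succ_tf_succ]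
    · simp [pairPoly, ih, ncard_pairWords_succ_tt]

/-! ### Intervals correspond to words of pairs -/

theorem isChain_compatiblePair_iff (L : List (Bool × Bool)) :
    L.IsChain CompatiblePair ↔ NoFalseFalse (L.map Prod.fst) ∧ NoFalseFalse (L.map Prod.snd) := by
  induction L with
  | nil => simp [NoFalseFalse]
  | cons x L ih =>
    rcases L with _ | ⟨y, L⟩
    · simp [NoFalseFalse]
    · simp only [List.isChain_cons_cons, NoFalseFalse, List.map_cons, CompatiblePair] at ih ⊢
      rw [ih]
      tauto

theorem isCode_of_mem_pairWords {n h : ℕ} {L : List (Bool × Bool)}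
    (hL : L ∈ pairWords n (true, true) h) :
    IsCode n (L.map Prod.fst) ∧ IsCode n (L.map Prod.snd) := by
  obtain ⟨h1, h2, h3, h4, h5⟩ := hL
  rw [isChain_compatiblePair_iff] at h2
  refine ⟨⟨by simpa using h1, h2.1, ?_⟩, ⟨by simpa using h1, h2.2, ?_⟩⟩
  all_goals
    rcases L with _ | ⟨x, L⟩
    · simp
    · simp at h4
      simp [h4]

theorem IsCode.firstAscent_eq_add_iff {n : ℕ} {l l' : List Bool} (h : IsCode n l)
    (h' : IsCode n l') (k : ℕ) :
    h'.toFibPath.firstAscent = h.toFibPath.firstAscent + k ↔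
      l.count true = l'.count true + k := by
  have e1 := count_false_add_count_true l
  have e2 := count_false_add_count_true l'
  have hl := h.length_eq
  have hl' := h'.length_eq
  rw [h.firstAscent_toFibPath, h'.firstAscent_toFibPath]
  rcases l with _ | ⟨b, l⟩ <;> rcases l' with _ | ⟨b', l'⟩
  · simp
  · simp at hl hl'; omega
  · simp at hl hl'; omega
  · simp only [reduceCtorEq, if_false]
    omega

/-- The interval encoded by a word of pairs. -/
def intervalOfPairWord {n k : ℕ} (L : pairWords n (true, true) k) :
    {I : NonemptyInterval (FibPath 2 n) // I.snd.firstAscent = I.fst.firstAscent + k} :=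
  have h := isCode_of_mem_pairWords L.2
  ⟨⟨⟨h.1.toFibPath, h.2.toFibPath⟩, (h.1.toFibPath_le_iff h.2).2 L.2.2.2.1⟩,
    (h.1.firstAscent_eq_add_iff h.2 k).2 L.2.2.2.2.2⟩

theorem List.eq_of_map_fst_eq_of_map_snd_eq {α β : Type*} {L L' : List (α × β)}
    (h1 : L.map Prod.fst = L'.map Prod.fst) (h2 : L.map Prod.snd = L'.map Prod.snd) : L = L' := by
  rw [← List.zip_unzip L, ← List.zip_unzip L', List.unzip_eq_map, List.unzip_eq_map, h1, h2]

theorem intervalOfPairWord_bijective (n k : ℕ) :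
    Function.Bijective (intervalOfPairWord (n := n) (k := k)) := by
  constructor
  · intro L L' h
    have c := isCode_of_mem_pairWords L.2
    have c' := isCode_of_mem_pairWords L'.2
    have h' := congrArg (fun I => I.1.toProd) h
    have h1 : c.1.toFibPath = c'.1.toFibPath := congrArg Prod.fst h'
    have h2 : c.2.toFibPath = c'.2.toFibPath := congrArg Prod.snd h'
    exact Subtype.ext (List.eq_of_map_fst_eq_of_map_snd_eq
      (c.1.eq_of_toFibPath_eq c'.1 h1) (c.2.eq_of_toFibPath_eq c'.2 h2))
  · rintro ⟨⟨⟨P, Q⟩, hPQ⟩, hk⟩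
    obtain ⟨l, hl, rfl⟩ := P.exists_code
    obtain ⟨l', hl', rfl⟩ := Q.exists_code
    have hlen := hl.length_eq.trans hl'.length_eq.symm
    have m1 : (l.zip l').map Prod.fst = l := List.map_fst_zip hlen.le
    have m2 : (l.zip l').map Prod.snd = l' := List.map_snd_zip hlen.ge
    have hL : l.zip l' ∈ pairWords n (true, true) k := by
      refine ⟨by simp [hl.length_eq, hl'.length_eq], ?_, ?_, ?_, ?_⟩
      · rw [isChain_compatiblePair_iff, m1, m2]
        exact ⟨hl.noFalseFalse, hl'.noFalseFalse⟩
      · rw [m1, m2]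
        exact (hl.toFibPath_le_iff hl').1 hPQ
      · rcases hl.eq_nil_or with rfl | ⟨t, rfl⟩ <;> rcases hl'.eq_nil_or with rfl | ⟨t', rfl⟩ <;>
          simp
      · rw [m1, m2]
        exact (hl.firstAscent_eq_add_iff hl' k).1 hk
    refine ⟨⟨_, hL⟩, Subtype.ext (NonemptyInterval.ext (Prod.ext ?_ ?_))⟩
    · simp only [intervalOfPairWord, m1]
    · simp only [intervalOfPairWord, m2]

theorem intervalCountDiff_eq_ncard (n k : ℕ) :
    intervalCountDiff 2 n k = (pairWords n (true, true) k).ncard := by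
  rw [intervalCountDiff, ← Nat.card_congr (Equiv.ofBijective _ (intervalOfPairWord_bijective n k)),
    Nat.card_coe_set_eq]

theorem coeff_fibJ_eq_pairPoly (n : ℕ) :
    PowerSeries.coeff n fibJ = pairPoly n (true, true) := by
  ext k
  rw [coeff_fibJ, coeff_pairPoly, intervalCountDiff_eq_ncard]

theorem FibPath.firstAscent_mono {n : ℕ} {P Q : FibPath 2 n} (h : P ≤ Q) :
    P.firstAscent ≤ Q.firstAscent := by
  obtain ⟨l, hl, rfl⟩ := P.exists_code
  obtain ⟨l', hl', rfl⟩ := Q.exists_code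
  have h0 := (hl.toFibPath_le_iff hl').1 h 0
  have := (hl.firstAscent_eq_add_iff hl' (l.count true - l'.count true)).2
    (by simp at h0; omega)
  omega

/-- The intervals are sorted by a truncated subtraction of first ascents, which is the true
difference by `FibPath.firstAscent_mono`. -/
theorem intervalCount_eq_sum (n : ℕ) :
    intervalCount 2 n = ∑ k ∈ Finset.range (n + 1), intervalCountDiff 2 n k := by
  classical
  have := Fintype.ofFinite (NonemptyInterval (FibPath 2 n))
  rw [intervalCount, Nat.card_eq_fintype_card, ← Finset.card_univ,
    Finset.card_eq_sum_card_fiberwise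
      (f := fun I : NonemptyInterval (FibPath 2 n) => I.snd.firstAscent - I.fst.firstAscent)
      (t := Finset.range (n + 1))]
  · refine Finset.sum_congr rfl fun k _ => ?_
    rw [intervalCountDiff, Nat.card_eq_fintype_card, Fintype.card_subtype]
    congr 1
    ext I
    have := FibPath.firstAscent_mono I.fst_le_snd
    simp only [Finset.mem_filter, Finset.mem_univ, true_and]
    omega
  · intro I _
    have := I.snd.firstAscent_le
    simp
    omega

theorem map_evalRingHom_one_fibJ :
    PowerSeries.map (Polynomial.evalRingHom (1 : ℚ)) fibJ = fibJ1 := by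
  ext n
  simp [fibJ, fibJ1, intervalCount_eq_sum, Polynomial.eval_monomial]

/-! ### The functional equation and its solution -/

/-- The generating function of `pairPoly`, for a given first letter. -/
noncomputable def pairSeries (s : Bool × Bool) : PowerSeries (Polynomial ℚ) :=
  PowerSeries.mk fun n => pairPoly n s

theorem fibJ_eq_pairSeries : fibJ = pairSeries (true, true) := by
  ext1 n
  rw [coeff_fibJ_eq_pairPoly, pairSeries, PowerSeries.coeff_mk]

/-- The substitution `y = 0`. -/
noncomputable def setYZero : PowerSeries (Polynomial ℚ) →+* PowerSeries (Polynomial ℚ) :=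
  PowerSeries.map (Polynomial.C.comp Polynomial.constantCoeff)

theorem pairSeries_tt : pairSeries (true, true) = 1 + X * (pairSeries (true, true) +
    pairSeries (true, false) + pairSeries (false, true) + pairSeries (false, false)) := by
  ext1 n
  rcases n with _ | n
  · simp [pairSeries, pairPoly]
  · simp [pairSeries, pairPoly, PowerSeries.coeff_succ_X_mul, PowerSeries.coeff_one]

theorem pairSeries_tf : pairSeries (true, false) =
    X * (C Polynomial.X * (pairSeries (true, true) + pairSeries (false, true))) := by
  ext1 n
  rcases n with _ | n
  · simp [pairSeries, pairPoly]
  · simp [pairSeries, pairPoly, PowerSeries.coeff_succ_X_mul, mul_add]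

theorem pairSeries_ff : pairSeries (false, false) = X * pairSeries (true, true) := by
  ext1 n
  rcases n with _ | n
  · simp [pairSeries, pairPoly]
  · simp [pairSeries, pairPoly, PowerSeries.coeff_succ_X_mul]

/-- Multiplying `divX` by `y` restores a polynomial without its constant term. Words starting with
`(true, false)` have positive difference, so that term comes from `(true, true)` alone. -/
theorem C_X_mul_pairSeries_ft : C Polynomial.X * pairSeries (false, true) =
    X * (pairSeries (true, true) + pairSeries (true, false) -
      setYZero (pairSeries (true, true))) := by
  have h0 : ∀ n, (pairPoly n (true, false)).coeff 0 = 0 := by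
    intro n
    rw [coeff_pairPoly]
    rcases n with _ | n
    · simp [ncard_pairWords_zero]
    · simp [ncard_pairWords_succ_tf_zero]
  ext1 n
  rcases n with _ | n
  · simp [pairSeries, pairPoly]
  · have := Polynomial.divX_mul_X_add (pairPoly n (true, true) + pairPoly n (true, false))
    simp [h0] at this
    simp [pairSeries, pairPoly, PowerSeries.coeff_succ_X_mul, setYZero]
    linear_combination this

theorem kernel_equation :
    ((1 - X ^ 2) * (C Polynomial.X * (1 - X - X ^ 2) - X ^ 2) - X ^ 2 * (X + C Polynomial.X) ^ 2)
      * fibJ = (1 - X ^ 2) * C Polynomial.X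
        - X ^ 2 * (1 + X * C Polynomial.X) * setYZero fibJ := by
  rw [fibJ_eq_pairSeries]
  linear_combination (1 - X ^ 2) * (C Polynomial.X * pairSeries_tt + X * C_X_mul_pairSeries_ft
    + X * C Polynomial.X * pairSeries_ff) + (X * C Polynomial.X + X ^ 2) *
      (pairSeries_tf + X * C_X_mul_pairSeries_ft)

/-- Uniqueness for the functional equation: a power of `X` dividing `δ` also divides `setYZero δ`,
and the extra factor `X` on the right raises that power by one, since the constant coefficient of
`A` is a nonzero element of a domain. -/
theorem eq_zero_of_mul_eq_X_mul {A M δ : PowerSeries (Polynomial ℚ)}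
    (hA : PowerSeries.constantCoeff A ≠ 0) (h : A * δ = X * M * setYZero δ) : δ = 0 := by
  have hX : setYZero X = X := by simp [setYZero]
  have key : ∀ n : ℕ, (X : PowerSeries (Polynomial ℚ)) ^ n ∣ δ := by
    intro n
    induction n with
    | zero => simp
    | succ n ih =>
      obtain ⟨ε, rfl⟩ := ih
      have h1 : A * ε = X * M * setYZero ε := by
        refine mul_left_cancel₀ (pow_ne_zero n PowerSeries.X_ne_zero) ?_
        rw [map_mul, map_pow, hX] at h
        linear_combination h
      have h2 := congrArg PowerSeries.constantCoeff h1
      simp [hA] at h2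
      rw [pow_succ]
      exact mul_dvd_mul_left _ (PowerSeries.X_dvd_iff.2 h2)
  ext1 n
  simpa using PowerSeries.X_pow_dvd_iff.1 (key (n + 1)) n (Nat.lt_succ_self n)

theorem constantCoeff_denJ {S : PowerSeries ℚ} (h1 : PowerSeries.constantCoeff S = 1) :
    PowerSeries.constantCoeff (denJ S) = 2 := by
  have : PowerSeries.constantCoeff (PowerSeries.map Polynomial.C S) = 1 := by
    rw [← PowerSeries.coeff_zero_eq_constantCoeff_apply, PowerSeries.coeff_map,
      PowerSeries.coeff_zero_eq_constantCoeff_apply, h1, map_one]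
  simp [denJ, this]
  norm_num

theorem isUnit_denJ {S : PowerSeries ℚ} (h1 : PowerSeries.constantCoeff S = 1) :
    IsUnit (denJ S) := by
  rw [PowerSeries.isUnit_iff_constantCoeff, constantCoeff_denJ h1]
  exact (isUnit_iff_ne_zero.2 (two_ne_zero' ℚ)).map Polynomial.C

theorem setYZero_map_C (S : PowerSeries ℚ) :
    setYZero (PowerSeries.map Polynomial.C S) = PowerSeries.map Polynomial.C S := by
  ext1 n
  simp [setYZero]

theorem fibJ_mul_denJ {S : PowerSeries ℚ} (h1 : PowerSeries.constantCoeff S = 1)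
    (h2 : S ^ 2 = X ^ 4 - 2 * X ^ 3 - X ^ 2 - 2 * X + 1) : fibJ * denJ S = numJ S := by
  have hS : (PowerSeries.map Polynomial.C S) ^ 2 = X ^ 4 - 2 * X ^ 3 - X ^ 2 - 2 * X + 1 := by
    rw [← map_pow, h2]
    simp [map_ofNat (PowerSeries.map (Polynomial.C (R := ℚ))) 2]
  have hN : setYZero (numJ S) = numJ S := by
    simp only [numJ, map_add, map_sub, map_pow, map_one, setYZero_map_C]
    simp [setYZero]
  have hD : setYZero (denJ S) = (1 - X ^ 2) * PowerSeries.map Polynomial.C S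
    + 1 + X ^ 4 - X ^ 3 - 2 * X ^ 2 - X := by
    simp only [denJ, map_add, map_sub, map_mul, map_pow, map_one, setYZero_map_C,
      map_ofNat setYZero 2]
    simp [setYZero]
  have hc : PowerSeries.constantCoeff (setYZero (denJ S)) = 2 := by
    rw [← PowerSeries.coeff_zero_eq_constantCoeff_apply, setYZero, PowerSeries.coeff_map,
      PowerSeries.coeff_zero_eq_constantCoeff_apply, constantCoeff_denJ h1, map_ofNat]
  -- The candidate is `numJ S / denJ S`, whose numerator is free of `y`; at `y = 0` it becomes `numJ
  -- S / setYZero (denJ S)`. Multiplying the kernel equation by both denominators gives this `A` and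
  -- `M`.
  refine sub_eq_zero.1 (eq_zero_of_mul_eq_X_mul
    (A := ((1 - X ^ 2) * (C Polynomial.X * (1 - X - X ^ 2) - X ^ 2)
      - X ^ 2 * (X + C Polynomial.X) ^ 2) * setYZero (denJ S))
    (M := -X * (1 + X * C Polynomial.X) * denJ S) ?_ ?_)
  · rw [map_mul, hc]
    simp
  · rw [map_sub, map_mul, hN, hD]
    have hk := kernel_equation
    generalize setYZero fibJ = E0 at hk ⊢
    unfold numJ denJ
    generalize PowerSeries.map Polynomial.C S = T at hS ⊢
    generalize (C Polynomial.X : PowerSeries (Polynomial ℚ)) = y at hk ⊢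
    generalize fibJ = E at hk ⊢
    linear_combination ((1 - X ^ 2) * T + 1 + X ^ 4 - X ^ 3 - 2 * X ^ 2 - X) *
      ((1 - X ^ 2) * T + 1 + X ^ 4 - X ^ 3 - 2 * (y + 1) * X ^ 2 - X) * hk +
      (1 - X ^ 2) * ((1 - X ^ 2) ^ 2 * y
        - ((1 - X ^ 2) * (y * (1 - X - X ^ 2) - X ^ 2) - X ^ 2 * (X + y) ^ 2)
        - X ^ 2 * (1 + X * y)) * hS

theorem fibJ1_mul {S : PowerSeries ℚ} (h1 : PowerSeries.constantCoeff S = 1)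
    (h2 : S ^ 2 = X ^ 4 - 2 * X ^ 3 - X ^ 2 - 2 * X + 1) :
    fibJ1 * (2 * X * (X ^ 2 - 3 * X + 1) * (X + 1)) = -X ^ 2 + 3 * X - 1 + S := by
  have hS : PowerSeries.map (Polynomial.evalRingHom (1 : ℚ)) (PowerSeries.map Polynomial.C S)
      = S := by
    ext n
    simp
  have h := congrArg (PowerSeries.map (Polynomial.evalRingHom (1 : ℚ))) (fibJ_mul_denJ h1 h2)
  rw [map_mul, map_evalRingHom_one_fibJ] at h
  have hD : PowerSeries.map (Polynomial.evalRingHom (1 : ℚ)) (denJ S) =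
      (1 - X ^ 2) * S + 1 + X ^ 4 - X ^ 3 - 4 * X ^ 2 - X := by
    simp only [denJ, map_add, map_sub, map_mul, map_pow, map_one, hS,
      map_ofNat (PowerSeries.map (Polynomial.evalRingHom (1 : ℚ))) 2]
    simp
    ring
  have hN : PowerSeries.map (Polynomial.evalRingHom (1 : ℚ)) (numJ S) = 1 + X - X ^ 2 + S := by
    simp only [numJ, map_add, map_sub, map_pow, map_one, hS]
    simp
  have h0 : (1 - X ^ 2) * S + 1 + X ^ 4 - X ^ 3 - 4 * X ^ 2 - X ≠ 0 := by
    intro h0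
    have := congrArg PowerSeries.constantCoeff h0
    simp [h1] at this
  rw [hD, hN] at h
  refine mul_right_cancel₀ h0 ?_
  -- After multiplication by the denominator at `y = 1`, the two sides agree modulo the equation for
  -- `S ^ 2`.
  linear_combination (2 * X * (X ^ 2 - 3 * X + 1) * (X + 1)) * h - (1 - X ^ 2) * h2

/-! ### Square roots of power series -/

/-- The series of `(1 - x)^(-1/2)`. -/
noncomputable def invSqrtSeries (F : Type*) [Field F] : PowerSeries F :=
  PowerSeries.mk fun n => (n.centralBinom : F) / 4 ^ n

theorem invSqrtSeries_coeff_succ (F : Type*) [Field F] [CharZero F] (n : ℕ) :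
    ((n + 1).centralBinom : F) / 4 ^ (n + 1) * (2 * (n + 1)) =
      (n.centralBinom : F) / 4 ^ n * (2 * n + 1) := by
  have h : ((n : F) + 1) * (n + 1).centralBinom = 2 * (2 * n + 1) * n.centralBinom := by
    exact_mod_cast congrArg (Nat.cast (R := F)) (Nat.succ_mul_centralBinom_succ n)
  have h4 : (4 : F) ≠ 0 := by norm_num
  field_simp
  rw [pow_succ]
  linear_combination 2 * h * 4 ^ n

theorem derivative_invSqrtSeries (F : Type*) [Field F] [CharZero F] :
    2 * ((1 - X) * PowerSeries.derivative F (invSqrtSeries F)) = invSqrtSeries F := by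
  ext n
  rw [sub_mul, one_mul, mul_sub, map_sub, ← map_ofNat (C (R := F)) 2, PowerSeries.coeff_C_mul,
    PowerSeries.coeff_C_mul]
  have h := invSqrtSeries_coeff_succ F n
  rcases n with _ | n
  · simp [invSqrtSeries, PowerSeries.coeff_derivative] at h ⊢
    linear_combination h
  · simp [invSqrtSeries, PowerSeries.coeff_derivative, PowerSeries.coeff_succ_X_mul] at h ⊢
    linear_combination h

/-- With `B` the series, the derivative of `(1 - X) B²` is `B (2 (1 - X) B' - B)`, which vanishes by
`derivative_invSqrtSeries`. -/
theorem invSqrtSeries_sq (F : Type*) [Field F] [CharZero F] :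
    (1 - X) * invSqrtSeries F ^ 2 = 1 := by
  refine PowerSeries.derivative.ext ?_ ?_
  · have h := derivative_invSqrtSeries F
    simp only [sq, Derivation.leibniz, smul_eq_mul, map_sub, Derivation.map_one_eq_zero,
      PowerSeries.derivative_X]
    linear_combination invSqrtSeries F * h
  · simp [invSqrtSeries]

/-- Substituting `1 - f` for `X` in `(1 - X) B² = 1` gives `f g² = 1`, so `f g` is a square root of
`f`, up to the sign of its constant term. -/
theorem exists_sq_eq {F : Type*} [Field F] [CharZero F] (f : PowerSeries F)
    (hf : PowerSeries.constantCoeff f = 1) :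
    ∃ S : PowerSeries F, PowerSeries.constantCoeff S = 1 ∧ S ^ 2 = f := by
  have hs : PowerSeries.HasSubst (1 - f) :=
    PowerSeries.HasSubst.of_constantCoeff_zero' (by simp [hf])
  have h := congrArg (PowerSeries.substAlgHom (R := F) hs) (invSqrtSeries_sq F)
  have hX : PowerSeries.substAlgHom (R := F) hs X = 1 - f := by
    rw [PowerSeries.coe_substAlgHom, PowerSeries.subst_X hs]
  simp only [map_mul, map_sub, map_one, map_pow, hX, sub_sub_cancel] at h
  set g : PowerSeries F := PowerSeries.substAlgHom (R := F) hs (invSqrtSeries F)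
  have hc := congrArg PowerSeries.constantCoeff h
  simp [hf] at hc
  have h' : (f * g) ^ 2 = f := by linear_combination f * h
  rcases hc with hc | hc
  · exact ⟨f * g, by simp [hf, hc], h'⟩
  · exact ⟨-(f * g), by simp [hf, hc], by rw [neg_sq, h']⟩

/-! ### Growth of the coefficients of `(1 - x)^(-1/2)` -/

open Filter Topology

/-- The coefficients of `(1 - x)^(-1/2)`. -/
noncomputable def invSqrtCoeff (n : ℕ) : ℝ := (n.centralBinom : ℝ) / 4 ^ n

theorem invSqrtCoeff_succ (n : ℕ) :
    invSqrtCoeff (n + 1) * (2 * (n + 1)) = invSqrtCoeff n * (2 * n + 1) :=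
  invSqrtSeries_coeff_succ ℝ n

theorem invSqrtCoeff_pos (n : ℕ) : 0 < invSqrtCoeff n :=
  div_pos (by exact_mod_cast n.centralBinom_pos) (by positivity)

theorem invSqrtCoeff_le_one (n : ℕ) : invSqrtCoeff n ≤ 1 := by
  induction n with
  | zero => simp [invSqrtCoeff]
  | succ n ih =>
    have h := invSqrtCoeff_succ n
    have hp := invSqrtCoeff_pos n
    by_contra! hc
    have hn : (0 : ℝ) ≤ n := n.cast_nonneg
    nlinarith

/-- Consecutive coefficients have ratio `(2m + 1) / (2m + 2) ≥ 1/2`. This crude bound provides the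
domination in the transfer theorem. -/
theorem invSqrtCoeff_le_two_pow_mul (m k : ℕ) :
    invSqrtCoeff m ≤ 2 ^ k * invSqrtCoeff (m + k) := by
  induction k with
  | zero => simp
  | succ k ih =>
    have h := invSqrtCoeff_succ (m + k)
    have hp := invSqrtCoeff_pos (m + k)
    have hn : (0 : ℝ) ≤ (m + k : ℕ) := Nat.cast_nonneg _
    have h2 : invSqrtCoeff (m + k) ≤ 2 * invSqrtCoeff (m + k + 1) := by
      have : 0 < ((m + k : ℕ) : ℝ) + 1 := by positivity
      refine le_of_mul_le_mul_right ?_ this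
      nlinarith
    calc invSqrtCoeff m ≤ 2 ^ k * invSqrtCoeff (m + k) := ih
      _ ≤ 2 ^ k * (2 * invSqrtCoeff (m + k + 1)) := by gcongr
      _ = 2 ^ (k + 1) * invSqrtCoeff (m + (k + 1)) := by rw [pow_succ, mul_assoc, add_assoc]

theorem wallis_mul_invSqrtCoeff_sq (n : ℕ) :
    Real.Wallis.W n * (invSqrtCoeff n ^ 2 * (2 * n + 1)) = 1 := by
  induction n with
  | zero => simp [Real.Wallis.W, invSqrtCoeff]
  | succ n ih =>
    have h : invSqrtCoeff (n + 1) = invSqrtCoeff n * (2 * n + 1) / (2 * (n + 1)) := by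
      rw [← invSqrtCoeff_succ]; field_simp
    have e : Real.Wallis.W (n + 1) * (invSqrtCoeff (n + 1) ^ 2 * (2 * ((n + 1 : ℕ) : ℝ) + 1))
        = Real.Wallis.W n * (invSqrtCoeff n ^ 2 * (2 * n + 1)) := by
      rw [Real.Wallis.W_succ, h]
      push_cast
      field_simp
      ring
    rw [e, ih]

theorem tendsto_invSqrtCoeff_sq_mul :
    Tendsto (fun n : ℕ => invSqrtCoeff n ^ 2 * (2 * n + 1)) atTop (𝓝 (2 / Real.pi)) := by
  have h := Real.Wallis.tendsto_W_nhds_pi_div_two.inv₀ (by positivity)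
  rw [inv_div] at h
  refine h.congr fun n => ?_
  exact inv_eq_of_mul_eq_one_right (wallis_mul_invSqrtCoeff_sq n)

/-- The shift by `k` is what the `k`-th term of a Cauchy product needs once `n` is replaced by `n +
k`. -/
theorem tendsto_invSqrtCoeff_mul_sqrt (k : ℕ) :
    Tendsto (fun n : ℕ => invSqrtCoeff n * √((n + k : ℕ) : ℝ)) atTop (𝓝 √(1 / Real.pi)) := by
  have h1 := tendsto_invSqrtCoeff_sq_mul
  have h2 : Tendsto (fun n : ℕ => (2 * (n : ℝ) + 1)⁻¹) atTop (𝓝 0) :=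
    tendsto_inv_atTop_zero.comp (tendsto_atTop_add_const_right _ _
      (tendsto_natCast_atTop_atTop.const_mul_atTop two_pos))
  have h3 : Tendsto (fun n : ℕ => invSqrtCoeff n ^ 2) atTop (𝓝 0) := by
    have := h1.mul h2
    rw [mul_zero] at this
    refine this.congr fun n => ?_
    have : (2 * (n : ℝ) + 1) ≠ 0 := by positivity
    field_simp
  have h4 := (h1.const_mul (1 / 2)).add (h3.const_mul ((k : ℝ) - 1 / 2))
  have h5 := (Real.continuous_sqrt.tendsto _).comp h4
  have e : 1 / 2 * (2 / Real.pi) + ((k : ℝ) - 1 / 2) * 0 = 1 / Real.pi := by ring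
  rw [e] at h5
  refine h5.congr fun n => ?_
  have e2 : 1 / 2 * (invSqrtCoeff n ^ 2 * (2 * n + 1)) + ((k : ℝ) - 1 / 2) * invSqrtCoeff n ^ 2
      = invSqrtCoeff n ^ 2 * ((n + k : ℕ) : ℝ) := by push_cast; ring
  simp only [Function.comp, e2]
  rw [Real.sqrt_mul (sq_nonneg _), Real.sqrt_sq (invSqrtCoeff_pos n).le]

/-! ### Summation of power series and coefficient transfer -/

/-- Absolute convergence of a power series at `r`. -/
def AbsSummableAt (f : PowerSeries ℝ) (r : ℝ) : Prop :=
  Summable fun n => ‖PowerSeries.coeff n f * r ^ n‖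

/-- The sum of a power series at `r`. -/
noncomputable def sumAt (f : PowerSeries ℝ) (r : ℝ) : ℝ := ∑' n, PowerSeries.coeff n f * r ^ n

theorem coeff_mul_mul_pow (f g : PowerSeries ℝ) (r : ℝ) (n : ℕ) :
    PowerSeries.coeff n (f * g) * r ^ n = ∑ kl ∈ Finset.HasAntidiagonal.antidiagonal n,
      (PowerSeries.coeff kl.1 f * r ^ kl.1) * (PowerSeries.coeff kl.2 g * r ^ kl.2) := by
  rw [PowerSeries.coeff_mul, Finset.sum_mul]
  refine Finset.sum_congr rfl fun kl h => ?_
  rw [← Finset.HasAntidiagonal.mem_antidiagonal.1 h, pow_add]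
  ring

theorem AbsSummableAt.mul {f g : PowerSeries ℝ} {r : ℝ} (hf : AbsSummableAt f r)
    (hg : AbsSummableAt g r) : AbsSummableAt (f * g) r := by
  unfold AbsSummableAt
  simp only [coeff_mul_mul_pow]
  exact summable_norm_sum_mul_antidiagonal_of_summable_norm
    (f := fun n => PowerSeries.coeff n f * r ^ n)
    (g := fun n => PowerSeries.coeff n g * r ^ n) hf hg

theorem sumAt_mul {f g : PowerSeries ℝ} {r : ℝ} (hf : AbsSummableAt f r)
    (hg : AbsSummableAt g r) : sumAt (f * g) r = sumAt f r * sumAt g r := by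
  unfold sumAt
  simp only [coeff_mul_mul_pow]
  exact (tsum_mul_tsum_eq_tsum_sum_antidiagonal_of_summable_norm
    (f := fun n => PowerSeries.coeff n f * r ^ n)
    (g := fun n => PowerSeries.coeff n g * r ^ n) hf hg).symm

theorem absSummableAt_polynomial (p : Polynomial ℝ) (r : ℝ) :
    AbsSummableAt (p : PowerSeries ℝ) r := by
  refine summable_of_ne_finset_zero (s := p.support) fun n hn => ?_
  simp [Polynomial.notMem_support_iff.1 hn]

theorem sumAt_polynomial (p : Polynomial ℝ) (r : ℝ) :
    sumAt (p : PowerSeries ℝ) r = p.eval r := by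
  rw [Polynomial.eval_eq_sum, Polynomial.sum, sumAt, tsum_eq_sum (s := p.support)]
  · simp
  · intro n hn
    simp [Polynomial.notMem_support_iff.1 hn]

theorem absSummableAt_of_coeff_le_one {f : PowerSeries ℝ} (hf : ∀ n, |PowerSeries.coeff n f| ≤ 1)
    {r : ℝ} (h0 : 0 ≤ r) (h1 : r < 1) : AbsSummableAt f r := by
  refine Summable.of_nonneg_of_le (fun _ => norm_nonneg _) (fun n => ?_)
    (summable_geometric_of_lt_one h0 h1)
  rw [Real.norm_eq_abs, abs_mul, abs_of_nonneg (pow_nonneg h0 n)]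
  exact mul_le_of_le_one_left (pow_nonneg h0 n) (hf n)

theorem sumAt_nonneg {f : PowerSeries ℝ} (hf : ∀ n, 0 ≤ PowerSeries.coeff n f) {r : ℝ}
    (h0 : 0 ≤ r) : 0 ≤ sumAt f r :=
  tsum_nonneg fun n => mul_nonneg (hf n) (pow_nonneg h0 n)

/-- Transfer for a square root singularity at `ρ`. -/
theorem tendsto_coeff_mul_rescale_invSqrtSeries {g : PowerSeries ℝ} {ρ t : ℝ}
    (ht : t * ρ = 1) (hg : AbsSummableAt g (2 * ρ)) :
    Tendsto (fun n : ℕ => PowerSeries.coeff n (g * PowerSeries.rescale t (invSqrtSeries ℝ))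
      * ρ ^ n * √(n : ℝ)) atTop (𝓝 (sumAt g ρ * √(1 / Real.pi))) := by
  obtain ⟨M, hM⟩ := (tendsto_invSqrtCoeff_mul_sqrt 0).bddAbove_range
  have hM' : ∀ n : ℕ, invSqrtCoeff n * √(n : ℝ) ≤ M := fun n => hM ⟨n, rfl⟩
  have key : ∀ n : ℕ, PowerSeries.coeff n (g * PowerSeries.rescale t (invSqrtSeries ℝ))
      * ρ ^ n * √(n : ℝ) = ∑' k, if k ≤ n then PowerSeries.coeff k g * ρ ^ k *
        (invSqrtCoeff (n - k) * √(n : ℝ)) else 0 := by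
    intro n
    rw [tsum_eq_sum (s := Finset.range (n + 1)), PowerSeries.coeff_mul,
      Finset.Nat.sum_antidiagonal_eq_sum_range_succ_mk, Finset.sum_mul, Finset.sum_mul]
    · refine Finset.sum_congr rfl fun k hk => ?_
      have hk : k ≤ n := by simpa [Nat.lt_succ_iff] using hk
      rw [if_pos hk, PowerSeries.coeff_rescale, invSqrtSeries, PowerSeries.coeff_mk]
      have e : ρ ^ n = ρ ^ k * ρ ^ (n - k) := by rw [← pow_add, Nat.add_sub_cancel' hk]
      have e2 : t ^ (n - k) * ρ ^ (n - k) = 1 := by rw [← mul_pow, ht, one_pow]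
      rw [e, invSqrtCoeff]
      linear_combination PowerSeries.coeff k g * ρ ^ k *
        (((n - k).centralBinom : ℝ) / 4 ^ (n - k)) * √(n : ℝ) * e2
    · intro k hk
      rw [if_neg (by simpa [Nat.lt_succ_iff] using hk)]
  simp only [key]
  rw [sumAt, ← tsum_mul_right]
  -- The bound `invSqrtCoeff (n - k) ≤ 2 ^ k * invSqrtCoeff n` dominates the `k`-th term by `M`
  -- times the norm of the `k`-th term of `g` at `2ρ`; hence the hypothesis at twice the radius.
  refine tendsto_tsum_of_dominated_convergence (hg.mul_right M) (fun k => ?_)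
    (Eventually.of_forall fun n k => ?_)
  · rw [← tendsto_add_atTop_iff_nat k]
    refine ((tendsto_invSqrtCoeff_mul_sqrt k).const_mul (PowerSeries.coeff k g * ρ ^ k)).congr
      fun n => ?_
    rw [if_pos (Nat.le_add_left _ _), Nat.add_sub_cancel]
  · have hM0 : 0 ≤ M := le_trans (by positivity [invSqrtCoeff_pos 0]) (hM' 0)
    split_ifs with hk
    · have h1 : invSqrtCoeff (n - k) * √(n : ℝ) ≤ 2 ^ k * M := by
        have := invSqrtCoeff_le_two_pow_mul (n - k) k
        rw [Nat.sub_add_cancel hk] at this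
        calc invSqrtCoeff (n - k) * √(n : ℝ) ≤ 2 ^ k * invSqrtCoeff n * √(n : ℝ) := by gcongr
          _ ≤ 2 ^ k * M := by rw [mul_assoc]; gcongr; exact hM' n
      have h2 : 0 ≤ invSqrtCoeff (n - k) * √(n : ℝ) :=
        mul_nonneg (invSqrtCoeff_pos _).le (Real.sqrt_nonneg _)
      rw [norm_mul, Real.norm_of_nonneg h2, mul_pow, norm_mul, norm_mul, norm_mul,
        Real.norm_of_nonneg (by positivity : (0 : ℝ) ≤ 2 ^ k)]
      calc _ ≤ ‖PowerSeries.coeff k g‖ * ‖ρ ^ k‖ * (2 ^ k * M) := by gcongr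
        _ = _ := by ring
    · rw [norm_zero]; positivity

/-! ### Splitting off the dominant singularity -/

theorem one_sub_C_mul_X_mul_rescale_sq (t : ℝ) :
    (1 - C t * X) * PowerSeries.rescale t (invSqrtSeries ℝ) ^ 2 = 1 := by
  have h := congrArg (PowerSeries.rescale t) (invSqrtSeries_sq ℝ)
  simpa [PowerSeries.rescale_X] using h

theorem one_sub_X_cube_mul_expand_sq :
    (1 - X ^ 3) * PowerSeries.expand 3 three_ne_zero (invSqrtSeries ℝ) ^ 2 = 1 := by
  have h := congrArg (PowerSeries.expand 3 three_ne_zero) (invSqrtSeries_sq ℝ)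
  simpa [PowerSeries.expand_X] using h

theorem coeff_invSqrtSeries (n : ℕ) : PowerSeries.coeff n (invSqrtSeries ℝ) = invSqrtCoeff n := by
  rw [invSqrtSeries, PowerSeries.coeff_mk, invSqrtCoeff]

/-- The series of `1 / (1 + x)`. -/
noncomputable def invOneAddSeries : PowerSeries ℝ := PowerSeries.mk fun n => (-1) ^ n

theorem one_add_X_mul_invOneAddSeries : (1 + X) * invOneAddSeries = 1 := by
  ext n
  rcases n with _ | n
  · simp [invOneAddSeries]
  · simp [invOneAddSeries, add_mul, PowerSeries.coeff_succ_X_mul, PowerSeries.coeff_one, pow_succ]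

/-- The product of `B(x^3)`, `B(x)` and `B(ρ x)`, where `B(x) = (1 - x)^(-1/2)`. -/
noncomputable def invSqrtProd (ρ : ℝ) : PowerSeries ℝ :=
  PowerSeries.expand 3 three_ne_zero (invSqrtSeries ℝ) *
    (invSqrtSeries ℝ * PowerSeries.rescale ρ (invSqrtSeries ℝ))

/-- The factor of the generating function of the intervals which is analytic at `ρ`. -/
noncomputable def regularFactor (ρ : ℝ) : PowerSeries ℝ :=
  invOneAddSeries * ((((1 - Polynomial.X ^ 3 : Polynomial ℝ)) : PowerSeries ℝ) * invSqrtProd ρ)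

/-- All three factors have coefficients in `[0, 1]`. Getting `√(1 + x + x²)` from `1 - x³` and `1 -
x` is what makes this elementary bound available. -/
theorem invSqrtProd_sumAt {ρ r : ℝ} (hρ : 0 ≤ ρ) (hρ1 : ρ ≤ 1) (h0 : 0 ≤ r) (h1 : r < 1) :
    AbsSummableAt (invSqrtProd ρ) r ∧ 0 ≤ sumAt (invSqrtProd ρ) r := by
  have a1 : ∀ n, 0 ≤ PowerSeries.coeff n (PowerSeries.expand 3 three_ne_zero (invSqrtSeries ℝ)) ∧
      PowerSeries.coeff n (PowerSeries.expand 3 three_ne_zero (invSqrtSeries ℝ)) ≤ 1 := by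
    intro n
    rw [PowerSeries.coeff_expand, coeff_invSqrtSeries]
    split_ifs
    · exact ⟨(invSqrtCoeff_pos _).le, invSqrtCoeff_le_one _⟩
    · norm_num
  have a2 : ∀ n, 0 ≤ PowerSeries.coeff n (invSqrtSeries ℝ) ∧
      PowerSeries.coeff n (invSqrtSeries ℝ) ≤ 1 := by
    intro n
    rw [coeff_invSqrtSeries]
    exact ⟨(invSqrtCoeff_pos _).le, invSqrtCoeff_le_one _⟩
  have a3 : ∀ n, 0 ≤ PowerSeries.coeff n (PowerSeries.rescale ρ (invSqrtSeries ℝ)) ∧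
      PowerSeries.coeff n (PowerSeries.rescale ρ (invSqrtSeries ℝ)) ≤ 1 := by
    intro n
    rw [PowerSeries.coeff_rescale]
    exact ⟨mul_nonneg (pow_nonneg hρ n) (a2 n).1,
      mul_le_one₀ (pow_le_one₀ hρ hρ1) (a2 n).1 (a2 n).2⟩
  have b : ∀ f : PowerSeries ℝ, (∀ n, 0 ≤ PowerSeries.coeff n f ∧ PowerSeries.coeff n f ≤ 1) →
      AbsSummableAt f r ∧ 0 ≤ sumAt f r := fun f hf =>
    ⟨absSummableAt_of_coeff_le_one (fun n => by rw [abs_of_nonneg (hf n).1]; exact (hf n).2) h0 h1,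
      sumAt_nonneg (fun n => (hf n).1) h0⟩
  have s1 := b _ a1
  have s2 := b _ a2
  have s3 := b _ a3
  refine ⟨s1.1.mul (s2.1.mul s3.1), ?_⟩
  rw [invSqrtProd, sumAt_mul s1.1 (s2.1.mul s3.1), sumAt_mul s2.1 s3.1]
  exact mul_nonneg s1.2 (mul_nonneg s2.2 s3.2)

theorem absSummableAt_invOneAddSeries {r : ℝ} (h0 : 0 ≤ r) (h1 : r < 1) :
    AbsSummableAt invOneAddSeries r :=
  absSummableAt_of_coeff_le_one (fun n => by simp [invOneAddSeries]) h0 h1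

theorem absSummableAt_regularFactor {ρ r : ℝ} (hρ : 0 ≤ ρ) (hρ1 : ρ ≤ 1) (h0 : 0 ≤ r)
    (h1 : r < 1) : AbsSummableAt (regularFactor ρ) r :=
  (absSummableAt_invOneAddSeries h0 h1).mul
    ((absSummableAt_polynomial _ _).mul (invSqrtProd_sumAt hρ hρ1 h0 h1).1)

/-- This selects the root once `sumAt_regularFactor_sq` has given the square. -/
theorem sumAt_regularFactor_nonneg {ρ : ℝ} (hρ : 0 ≤ ρ) (hρ1 : ρ < 1) :
    0 ≤ sumAt (regularFactor ρ) ρ := by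
  have h := invSqrtProd_sumAt hρ hρ1.le hρ hρ1
  have e1 : sumAt ((1 + Polynomial.X : Polynomial ℝ) * invOneAddSeries) ρ = 1 := by
    have : (((1 + Polynomial.X : Polynomial ℝ)) : PowerSeries ℝ) * invOneAddSeries
        = ((1 : Polynomial ℝ) : PowerSeries ℝ) := by
      simpa using one_add_X_mul_invOneAddSeries
    rw [this, sumAt_polynomial, Polynomial.eval_one]
  rw [sumAt_mul (absSummableAt_polynomial _ _) (absSummableAt_invOneAddSeries hρ hρ1),
    sumAt_polynomial] at e1
  simp only [Polynomial.eval_add, Polynomial.eval_one, Polynomial.eval_X] at e1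
  rw [regularFactor, sumAt_mul (absSummableAt_invOneAddSeries hρ hρ1)
    ((absSummableAt_polynomial _ _).mul h.1), sumAt_mul (absSummableAt_polynomial _ _) h.1,
    sumAt_polynomial]
  have e2 : 0 ≤ sumAt invOneAddSeries ρ := by
    by_contra! hc
    nlinarith
  refine mul_nonneg e2 (mul_nonneg ?_ h.2)
  simp
  exact pow_le_one₀ hρ hρ1.le

theorem invSqrtProd_sq (ρ : ℝ) :
    (1 - X ^ 3) * ((1 - X) * (1 - C ρ * X)) * invSqrtProd ρ ^ 2 = 1 := by
  have h1 := one_sub_X_cube_mul_expand_sq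
  have h2 := invSqrtSeries_sq ℝ
  have h3 := one_sub_C_mul_X_mul_rescale_sq ρ
  rw [invSqrtProd]
  calc _ = ((1 - X ^ 3) * PowerSeries.expand 3 three_ne_zero (invSqrtSeries ℝ) ^ 2) *
        (((1 - X) * invSqrtSeries ℝ ^ 2) *
          ((1 - C ρ * X) * PowerSeries.rescale ρ (invSqrtSeries ℝ) ^ 2)) := by ring
    _ = 1 := by rw [h1, h2, h3]; ring

theorem sumAt_regularFactor_sq {ρ : ℝ} (hρ : 0 ≤ ρ) (hρ1 : ρ < 1) :
    (1 + ρ) ^ 2 * (1 - ρ) * (1 - ρ ^ 2) * sumAt (regularFactor ρ) ρ ^ 2 = 1 - ρ ^ 3 := by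
  have hs := absSummableAt_regularFactor hρ hρ1.le hρ hρ1
  have e : (((1 + Polynomial.X) ^ 2 * (1 - Polynomial.X) * (1 - Polynomial.C ρ * Polynomial.X) :
      Polynomial ℝ) : PowerSeries ℝ) * (regularFactor ρ * regularFactor ρ)
      = ((1 - Polynomial.X ^ 3 : Polynomial ℝ) : PowerSeries ℝ) := by
    have h1 := one_add_X_mul_invOneAddSeries
    have h2 := invSqrtProd_sq ρ
    simp only [regularFactor, Polynomial.coe_mul, Polynomial.coe_pow, Polynomial.coe_add,
      Polynomial.coe_sub, Polynomial.coe_one, Polynomial.coe_X, Polynomial.coe_C]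
    calc _ = ((1 + X) * invOneAddSeries) ^ 2 * (1 - X ^ 3) *
          ((1 - X ^ 3) * ((1 - X) * (1 - C ρ * X)) * invSqrtProd ρ ^ 2) := by ring
      _ = 1 - X ^ 3 := by rw [h1, h2]; ring
  have h := congrArg (fun f => sumAt f ρ) e
  simp only [sumAt_mul (absSummableAt_polynomial _ _) (hs.mul hs), sumAt_mul hs hs,
    sumAt_polynomial] at h
  simp at h
  linear_combination h

/-- With `q = X² - 3X + 1`, dividing the formula for `J(x,1)` by `q (1 + X)` leaves `(S/q - 1) / (1
+ X)`. Since `S² = q (1 - X³) / (1 - X)` and `q = (1 - tX)(1 - ρX)`, the quotient `S/q` is `(1 -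
X³)` times the four inverse square roots; constant terms fix the sign. -/
theorem map_fibJ1_eq {ρ t : ℝ} (hsum : t + ρ = 3) (hprod : t * ρ = 1) :
    2 * X * PowerSeries.map (algebraMap ℚ ℝ) fibJ1 =
      regularFactor ρ * PowerSeries.rescale t (invSqrtSeries ℝ) - invOneAddSeries := by
  obtain ⟨S, h1, h2⟩ := exists_sq_eq
    (X ^ 4 - 2 * X ^ 3 - X ^ 2 - 2 * X + 1 : PowerSeries ℚ) (by simp)
  have hJ := congrArg (PowerSeries.map (algebraMap ℚ ℝ)) (fibJ1_mul h1 h2)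
  have hS := congrArg (PowerSeries.map (algebraMap ℚ ℝ)) h2
  have hc : PowerSeries.constantCoeff (PowerSeries.map (algebraMap ℚ ℝ) S) = 1 := by
    rw [← PowerSeries.coeff_zero_eq_constantCoeff_apply, PowerSeries.coeff_map,
      PowerSeries.coeff_zero_eq_constantCoeff_apply, h1, map_one]
  simp only [map_mul, map_add, map_sub, map_neg, map_pow, map_one, PowerSeries.map_X,
    map_ofNat (PowerSeries.map (algebraMap ℚ ℝ)) 2,
    map_ofNat (PowerSeries.map (algebraMap ℚ ℝ)) 3] at hJ hS
  generalize PowerSeries.map (algebraMap ℚ ℝ) S = T at hJ hS hc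
  generalize PowerSeries.map (algebraMap ℚ ℝ) fibJ1 = J at hJ ⊢
  have hq : (X ^ 2 - 3 * X + 1 : PowerSeries ℝ) = (1 - C t * X) * (1 - C ρ * X) := by
    have e1 : (C t + C ρ : PowerSeries ℝ) = 3 := by rw [← map_add, hsum, map_ofNat]
    have e2 : (C t * C ρ : PowerSeries ℝ) = 1 := by rw [← map_mul, hprod, map_one]
    linear_combination X * e1 - X ^ 2 * e2
  have hq0 : (X ^ 2 - 3 * X + 1 : PowerSeries ℝ) ≠ 0 := by
    intro h
    simpa using congrArg PowerSeries.constantCoeff h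
  have hH := one_add_X_mul_invOneAddSeries
  have hB := one_sub_C_mul_X_mul_rescale_sq t
  have hP := invSqrtProd_sq ρ
  have hPc : PowerSeries.constantCoeff (invSqrtProd ρ) = 1 := by
    have : PowerSeries.constantCoeff (invSqrtSeries ℝ) = 1 := by simp [invSqrtSeries]
    rw [invSqrtProd, map_mul, map_mul, PowerSeries.constantCoeff_expand, this,
      ← PowerSeries.coeff_zero_eq_constantCoeff_apply (PowerSeries.rescale ρ _),
      PowerSeries.coeff_rescale, PowerSeries.coeff_zero_eq_constantCoeff_apply, this]
    norm_num
  have hBc : PowerSeries.constantCoeff (PowerSeries.rescale t (invSqrtSeries ℝ)) = 1 := by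
    rw [← PowerSeries.coeff_zero_eq_constantCoeff_apply, PowerSeries.coeff_rescale]
    simp [invSqrtSeries]
  rw [regularFactor]
  simp only [Polynomial.coe_sub, Polynomial.coe_one, Polynomial.coe_pow, Polynomial.coe_X]
  generalize PowerSeries.rescale t (invSqrtSeries ℝ) = B at hB hBc ⊢
  generalize invSqrtProd ρ = P at hP hPc ⊢
  generalize invOneAddSeries = H at hH ⊢
  have hT : T = (X ^ 2 - 3 * X + 1) * ((1 - X ^ 3) * P * B) := by
    have hX : (1 - X : PowerSeries ℝ) ≠ 0 := by
      intro h
      simpa using congrArg PowerSeries.constantCoeff h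
    have hsq : T ^ 2 = ((X ^ 2 - 3 * X + 1) * ((1 - X ^ 3) * P * B)) ^ 2 := by
      refine mul_left_cancel₀ hX ?_
      have e : (1 - X) * ((X ^ 2 - 3 * X + 1) * ((1 - X ^ 3) * P * B)) ^ 2
          = (X ^ 2 - 3 * X + 1) * (1 - X ^ 3) *
            (((1 - X ^ 3) * ((1 - X) * (1 - C ρ * X)) * P ^ 2) * ((1 - C t * X) * B ^ 2)) := by
        linear_combination (X ^ 2 - 3 * X + 1) * (1 - X) * ((1 - X ^ 3) * P * B) ^ 2 * hq
      rw [e, hP, hB, hS]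
      ring
    rcases sq_eq_sq_iff_eq_or_eq_neg.1 hsq with h | h
    · exact h
    · have := congrArg PowerSeries.constantCoeff h
      simp [hc, hPc, hBc] at this
      norm_num at this
  rw [hT] at hJ
  refine mul_left_cancel₀ hq0 ?_
  linear_combination H * hJ - 2 * X * (X ^ 2 - 3 * X + 1) * J * hH

theorem intervalCount_eq_coeff {ρ t : ℝ} (hsum : t + ρ = 3) (hprod : t * ρ = 1) (n : ℕ) :
    2 * (intervalCount 2 n : ℝ) = PowerSeries.coeff (n + 1)
      (regularFactor ρ * PowerSeries.rescale t (invSqrtSeries ℝ)) - (-1) ^ (n + 1) := by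
  have h := congrArg (PowerSeries.coeff (n + 1)) (map_fibJ1_eq hsum hprod)
  have e : 2 * X * PowerSeries.map (algebraMap ℚ ℝ) fibJ1 =
      X * (C (2 : ℝ) * PowerSeries.map (algebraMap ℚ ℝ) fibJ1) := by
    rw [map_ofNat]
    ring
  rw [e, PowerSeries.coeff_succ_X_mul, PowerSeries.coeff_C_mul] at h
  simpa [fibJ1, invOneAddSeries] using h

theorem tendsto_intervalCount {ρ t : ℝ} (hρ : 0 < ρ) (hρ2 : 2 * ρ < 1) (hsum : t + ρ = 3)
    (hprod : t * ρ = 1) :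
    Tendsto (fun n : ℕ => (intervalCount 2 n : ℝ) * ρ ^ n * √(n : ℝ)) atTop
      (𝓝 (sumAt (regularFactor ρ) ρ * √(1 / Real.pi) / (2 * ρ))) := by
  have h1 := (tendsto_coeff_mul_rescale_invSqrtSeries hprod
    (absSummableAt_regularFactor hρ.le (by linarith) (by linarith) hρ2)).comp
      (tendsto_add_atTop_nat 1)
  have h2 : Tendsto (fun n : ℕ => (-1 : ℝ) ^ n * ρ ^ n * √(n : ℝ)) atTop (𝓝 0) := by
    have h := tendsto_self_mul_const_pow_of_lt_one hρ.le (by linarith)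
    refine squeeze_zero_norm (fun n => ?_) h
    rw [norm_mul, norm_mul, norm_pow, norm_neg, norm_one, one_pow, one_mul,
      Real.norm_of_nonneg (pow_nonneg hρ.le n), Real.norm_of_nonneg (Real.sqrt_nonneg _), mul_comm]
    refine mul_le_mul_of_nonneg_right ?_ (pow_nonneg hρ.le n)
    rw [Real.sqrt_le_left (Nat.cast_nonneg n)]
    exact_mod_cast Nat.le_self_pow two_ne_zero n
  have h3 := ((h1.sub (h2.comp (tendsto_add_atTop_nat 1))).div_const (2 * ρ))
  -- The factor `2x` in front of `J(x,1)` shifts the index by one; this limit turns `√(n + 1)` back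
  -- into `√n`.
  have h4 : Tendsto (fun n : ℕ => √((n : ℝ) / (n + 1))) atTop (𝓝 1) := by
    have h := (Real.continuous_sqrt.tendsto _).comp (tendsto_natCast_div_add_atTop (1 : ℝ))
    rwa [Real.sqrt_one] at h
  have h5 := h3.mul h4
  rw [sub_zero, mul_one] at h5
  refine h5.congr fun n => ?_
  have e := intervalCount_eq_coeff hsum hprod n
  have hn : (0 : ℝ) < (n : ℝ) + 1 := by positivity
  have hs : √((n : ℝ) + 1) ≠ 0 := (Real.sqrt_pos.2 hn).ne'
  simp only [Function.comp, Nat.cast_add, Nat.cast_one]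
  rw [eq_add_of_sub_eq e.symm, Real.sqrt_div (Nat.cast_nonneg n), pow_succ ρ]
  field_simp
  ring

/-! ### The constant and the asymptotic equivalence -/

theorem asymptotic_constant_eq :
    sumAt (regularFactor ((3 - √5) / 2)) ((3 - √5) / 2) * √(1 / Real.pi) / (2 * ((3 - √5) / 2)) =
      (11 + 5 * √5) / 20 * √((14 * √5 - 30) / Real.pi) := by
  have hs : √5 ^ 2 = (5 : ℝ) := Real.sq_sqrt (by norm_num)
  have hs0 : (11 / 5 : ℝ) < √5 := Real.lt_sqrt_of_sq_lt (by norm_num)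
  have hs1 : √5 < (9 / 4 : ℝ) := (Real.sqrt_lt' (by norm_num)).2 (by norm_num)
  -- Replacing `√5` by `3 - 2ρ` turns the comparison of squares into polynomial identities modulo
  -- `ρ² = 3ρ - 1`.
  obtain ⟨ρ, hρ⟩ : ∃ ρ, ρ = (3 - √5) / 2 := ⟨_, rfl⟩
  have hs' : √5 = 3 - 2 * ρ := by linarith
  rw [← hρ, hs']
  rw [hs'] at hs hs0 hs1
  have hr : ρ ^ 2 = 3 * ρ - 1 := by linarith
  have hr3 : ρ ^ 3 = 8 * ρ - 3 := by linear_combination (ρ + 3) * hr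
  have h0 : 0 < ρ := by linarith
  have h1 : ρ < 2 / 5 := by linarith
  have hv := sumAt_regularFactor_sq h0.le (by linarith)
  have hv0 := sumAt_regularFactor_nonneg h0.le (by linarith : ρ < 1)
  generalize sumAt (regularFactor ρ) ρ = v at hv hv0
  have hP : (1 + ρ) ^ 2 * (1 - ρ) * (1 - ρ ^ 2) ≠ 0 := by
    have : 0 < 1 - ρ := by linarith
    have : 0 < 1 - ρ ^ 2 := by nlinarith
    positivity
  have hw : 0 ≤ 14 * (3 - 2 * ρ) - 30 := by linarith
  have hvw : v = 2 * ρ * ((11 + 5 * (3 - 2 * ρ)) / 20) * √(14 * (3 - 2 * ρ) - 30) := by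
    refine (sq_eq_sq₀ hv0 ?_).1 ?_
    · have : 0 ≤ 11 + 5 * (3 - 2 * ρ) := by linarith
      positivity
    · refine mul_left_cancel₀ hP ?_
      rw [hv, mul_pow, Real.sq_sqrt hw]
      have e1 : (1 + ρ) ^ 2 * (1 - ρ) * (1 - ρ ^ 2) = 5 * (11 * ρ - 4) := by
        linear_combination (ρ ^ 3 + 4 * ρ ^ 2 + 10 * ρ + 24) * hr - hr3
      have e2 : (2 * ρ * ((11 + 5 * (3 - 2 * ρ)) / 20)) ^ 2 * (14 * (3 - 2 * ρ) - 30)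
          = (28 - 12 * ρ) / 25 := by
        linear_combination (-28 * ρ ^ 3 + 368 / 5 * ρ ^ 2 - 72 / 25 * ρ - 28 / 25) * hr
      rw [e1, e2, hr3]
      linear_combination (132 / 5) * hr
  rw [hvw, Real.sqrt_div hw, Real.sqrt_div zero_le_one, Real.sqrt_one]
  field_simp

theorem intervalCount_isEquivalent : Asymptotics.IsEquivalent Filter.atTop
    (fun n : ℕ => (intervalCount 2 n : ℝ))
    (fun n : ℕ => (11 + 5 * Real.sqrt 5) / 20
      * Real.sqrt ((14 * Real.sqrt 5 - 30) / Real.pi)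
      * (n : ℝ) ^ (-(1 / 2) : ℝ) * ((3 + Real.sqrt 5) / 2) ^ n) := by
  have hs : √5 ^ 2 = (5 : ℝ) := Real.sq_sqrt (by norm_num)
  have hs0 : (11 / 5 : ℝ) < √5 := Real.lt_sqrt_of_sq_lt (by norm_num)
  have hs1 : √5 < (9 / 4 : ℝ) := (Real.sqrt_lt' (by norm_num)).2 (by norm_num)
  have hprod : (3 + √5) / 2 * ((3 - √5) / 2) = 1 := by linear_combination -hs / 4
  have h := tendsto_intervalCount (ρ := (3 - √5) / 2) (t := (3 + √5) / 2) (by linarith)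
    (by linarith) (by ring) hprod
  rw [asymptotic_constant_eq] at h
  set c := (11 + 5 * √5) / 20 * √((14 * √5 - 30) / Real.pi) with hc
  have hc0 : 0 < c := by
    have : 0 < 14 * √5 - 30 := by linarith
    positivity
  have ht : (0 : ℝ) < (3 + √5) / 2 := by linarith
  refine (Asymptotics.isEquivalent_iff_tendsto_one ?_).2 ?_
  · filter_upwards [eventually_gt_atTop 0] with n hn
    have : (0 : ℝ) < n := by exact_mod_cast hn
    positivity
  · have h' := h.div_const c
    rw [div_self hc0.ne'] at h'
    refine h'.congr' ?_
    filter_upwards [eventually_gt_atTop 0] with n hn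
    have hn' : (0 : ℝ) < n := by exact_mod_cast hn
    have e : ((3 - √5) / 2) ^ n = (((3 + √5) / 2) ^ n)⁻¹ := by
      rw [← inv_pow, inv_eq_of_mul_eq_one_right hprod]
    rw [Pi.div_apply, e, Real.rpow_neg hn'.le, ← Real.sqrt_eq_rpow]
    have := Real.sqrt_pos.2 hn'
    field_simp

theorem mainTheorem11 :
    -- `S` is the formal power series `√(x⁴ - 2x³ - x² - 2x + 1)` with constant term `1`
    (∃ S : PowerSeries ℚ,
      PowerSeries.constantCoeff S = 1 ∧
      S ^ 2 = X ^ 4 - 2 * X ^ 3 - X ^ 2 - 2 * X + 1 ∧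
      IsUnit (denJ S) ∧
      fibJ * denJ S = numJ S ∧
      2 * X * (X ^ 2 - 3 * X + 1) * (X + 1) ≠ (0 : PowerSeries ℚ) ∧
      fibJ1 * (2 * X * (X ^ 2 - 3 * X + 1) * (X + 1)) = -X ^ 2 + 3 * X - 1 + S) ∧
    -- setting `y = 1` in `J(x, y)` counts all intervals
    PowerSeries.map (Polynomial.evalRingHom (1 : ℚ)) fibJ = fibJ1 ∧
    Asymptotics.IsEquivalent Filter.atTop
      (fun n : ℕ => (intervalCount 2 n : ℝ))
      (fun n : ℕ => (11 + 5 * Real.sqrt 5) / 20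
        * Real.sqrt ((14 * Real.sqrt 5 - 30) / Real.pi)
        * (n : ℝ) ^ (-(1 / 2) : ℝ) * ((3 + Real.sqrt 5) / 2) ^ n) := by
  obtain ⟨S, h1, h2⟩ := exists_sq_eq
    (X ^ 4 - 2 * X ^ 3 - X ^ 2 - 2 * X + 1 : PowerSeries ℚ) (by simp)
  refine ⟨⟨S, h1, h2, isUnit_denJ h1, fibJ_mul_denJ h1 h2, ?_, fibJ1_mul h1 h2⟩,
    map_evalRingHom_one_fibJ, intervalCount_isEquivalent⟩
  have hq : (X ^ 2 - 3 * X + 1 : PowerSeries ℚ) ≠ 0 := by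
    intro h
    simpa using congrArg PowerSeries.constantCoeff h
  have hX : (X + 1 : PowerSeries ℚ) ≠ 0 := by
    intro h
    simpa using congrArg PowerSeries.constantCoeff h
  have h2 : (2 : PowerSeries ℚ) ≠ 0 := by
    intro h
    have h' := congrArg PowerSeries.constantCoeff h
    rw [map_ofNat, map_zero] at h'
    exact two_ne_zero h'
  exact mul_ne_zero (mul_ne_zero (mul_ne_zero h2 PowerSeries.X_ne_zero) hq) hX
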